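/- Let $\tau>0$. On $\mathbb C^2=\mathbb R^4$ put $\langle v,w\rangle=\mathrm{Re}(v_1\bar w_1)-\mathrm{Re}(v_2\bar w_2)$ and identify $\mathrm{SL}(2,\mathbb R)$ with the quadric $\{(z,w)\in\mathbb C^2:\ |z|^2-|w|^2=1\}$. Let $X_1(z,w)=(iz,iw)$, $X_2(z,w)=(i\bar w,i\bar z)$, $X_3(z,w)=(\bar w,\bar z)$, and let $\mathrm{SL}(2,\mathbb R)_\tau$ be the quadric with the Riemannian metric $$g_\tau(X,Y)=-\langle X,Y\rangle+(1+\tau^2)\langle X,X_1\rangle\langle Y,X_1\rangle ,$$ for which $E_1=-\tau^{-1}X_1$ (the Hopf vector field), $E_2=X_2$, $E_3=X_3$ is an orthonormal frame. Let $\nabla^\tau$ be its Levi-Civita connection. A smooth curve $\gamma:I\to \mathrm{SL}(2,\mathbb R)_\tau$ on an open interval $I$ is *biharmonic* if it is a critical point of the bienergy $\frac12\int |\nabla^\tau_{\gamma'}\gamma'|^2\,ds$ with respect to smooth variations supported in compact subintervals of $I$; it is *proper biharmonic* if moreover it is not a geodesic, i.e. $\nabla^\tau_{\gamma'}\gamma'$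 is not identically zero. **Proposition.** Let $\gamma:I\to \mathrm{SL}(2,\mathbb R)_\tau$ be a proper biharmonic curve parametrized by arc length. Then $\gamma$ makes a constant angle $\vartheta\in(0,\pi)$ with the Hopf vector field $E_1$, and there is a smooth function $\beta:I\to\mathbb R$ such that, for all $s\in I$, $$\gamma'(s)=\cos\vartheta\,E_1+\sin\vartheta\sin\beta(s)\,E_2+\sin\vartheta\cos\beta(s)\,E_3 ,$$ where the $E_i$ are taken at $\gamma(s)$. Moreover, after reversing the orientation of $\gamma$ if necessary (that is, replacing $\gamma$ by $s\mapsto\gamma(-s)$ on $-I$), the same holds with $\vartheta\in(0,\pi/2]$. -/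

import Mathlib

open Set
open scoped ContDiff ComplexConjugate

noncomputable section

namespace SLTau

/-- The inner product of signature `(2,2)` on `ℝ⁴ = ℂ²`:
`⟨v, w⟩ = Re (v₁ w̄₁) - Re (v₂ w̄₂)`. -/
def pseudoInner (v w : ℂ × ℂ) : ℝ :=
  (v.1 * conj w.1).re - (v.2 * conj w.2).re

/-- The special linear group, as the quadric `|z|² - |w|² = 1` in `ℂ²`. -/
def SL2 : Set (ℂ × ℂ) := {p | pseudoInner p p = 1}

/-- The Hopf vector field `X₁ (z, w) = (i z, i w)`. -/
def X₁ (p : ℂ × ℂ) : ℂ × ℂ := (Complex.I * p.1, Complex.I * p.2)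

/-- The horizontal vector field `X₂ (z, w) = (i w̄, i z̄)`. -/
def X₂ (p : ℂ × ℂ) : ℂ × ℂ := (Complex.I * conj p.2, Complex.I * conj p.1)

/-- The horizontal vector field `X₃ (z, w) = (w̄, z̄)`. -/
def X₃ (p : ℂ × ℂ) : ℂ × ℂ := (conj p.2, conj p.1)

/-- The metric `g_τ` at the point `p`, evaluated on vectors `v`, `w` tangent to the quadric. -/
def metric (τ : ℝ) (p v w : ℂ × ℂ) : ℝ :=
  -pseudoInner v w + (1 + τ ^ 2) * pseudoInner v (X₁ p) * pseudoInner w (X₁ p)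

/-- The orthonormal frame `E₁ = -τ⁻¹ X₁`, `E₂ = X₂`, `E₃ = X₃`, indexed by `0, 1, 2`. -/
def frame (τ : ℝ) : Fin 3 → (ℂ × ℂ) → ℂ × ℂ :=
  ![fun p => (-τ⁻¹) • X₁ p, X₂, X₃]

/-- The coefficient `g_τ (∇_{E_i} E_j, E_k)` of the Levi-Civita connection, given by the Koszul
formula. The terms of that formula that differentiate the functions `g_τ (E_a, E_b)` are zero,
because the frame is orthonormal. The fields are tangent to the quadric, so their brackets on the
quadric are the brackets taken in the ambient space. -/
def connectionCoeff (τ : ℝ) (p : ℂ × ℂ) (i j k : Fin 3) : ℝ :=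
  (1 / 2) *
    (metric τ p (VectorField.lieBracket ℝ (frame τ i) (frame τ j) p) (frame τ k p)
      - metric τ p (VectorField.lieBracket ℝ (frame τ j) (frame τ k) p) (frame τ i p)
      + metric τ p (VectorField.lieBracket ℝ (frame τ k) (frame τ i) p) (frame τ j p))

/-- The covariant derivative `∇_{c'} V` of a vector field `V` along the curve `c`, for the
Levi-Civita connection of `g_τ`. With `V = ∑ V_j E_j` and `c' = ∑ T_i E_i` it is
`∑ V_k' E_k + ∑ T_i V_j ∇_{E_i} E_j`. -/
def covDeriv (τ : ℝ) (c V : ℝ → ℂ × ℂ) (s : ℝ) : ℂ × ℂ :=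
  ∑ k, (deriv (fun r => metric τ (c r) (V r) (frame τ k (c r))) s
      + ∑ i, ∑ j, metric τ (c s) (deriv c s) (frame τ i (c s))
          * metric τ (c s) (V s) (frame τ j (c s))
          * connectionCoeff τ (c s) i j k) • frame τ k (c s)

/-- The tension field `∇_{c'} c'` of a curve. -/
def tension (τ : ℝ) (c : ℝ → ℂ × ℂ) (s : ℝ) : ℂ × ℂ :=
  covDeriv τ c (deriv c) s

/-- The bienergy of a curve on the interval `[a, b]`. -/
def bienergy (τ : ℝ) (c : ℝ → ℂ × ℂ) (a b : ℝ) : ℝ :=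
  (1 / 2) * ∫ s in a..b, metric τ (c s) (tension τ c s) (tension τ c s)

/-- The curve `γ` (with domain the open interval `I`) is biharmonic: it is a critical point of the
bienergy with respect to all smooth variations through curves in the quadric that are supported
in a compact interval `[a, b] ⊆ I`. -/
def IsBiharmonic (τ : ℝ) (γ : ℝ → ℂ × ℂ) (I : Set ℝ) : Prop :=
  ∀ (ε a b : ℝ) (Γ : ℝ → ℝ → ℂ × ℂ), 0 < ε → a < b → Icc a b ⊆ I →
    ContDiffOn ℝ ∞ (fun q : ℝ × ℝ => Γ q.1 q.2) (Ioo (-ε) ε ×ˢ I) →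
    (∀ t ∈ Ioo (-ε) ε, ∀ s ∈ I, Γ t s ∈ SL2) →
    (∀ s ∈ I, Γ 0 s = γ s) →
    (∀ t ∈ Ioo (-ε) ε, ∀ s ∈ I \ Icc a b, Γ t s = γ s) →
    HasDerivAt (fun t => bienergy τ (Γ t) a b) 0 0

/-- A geodesic is a curve whose tension field vanishes. -/
def IsGeodesic (τ : ℝ) (γ : ℝ → ℂ × ℂ) (I : Set ℝ) : Prop :=
  ∀ s ∈ I, tension τ γ s = 0

/-- A proper biharmonic curve is a biharmonic curve that is not a geodesic. -/
def IsProperBiharmonic (τ : ℝ) (γ : ℝ → ℂ × ℂ) (I : Set ℝ) : Prop :=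
  IsBiharmonic τ γ I ∧ ¬ IsGeodesic τ γ I

/-- The angle at `p`, with respect to `g_τ`, between the tangent vectors `v` and `w`. -/
def angle (τ : ℝ) (p v w : ℂ × ℂ) : ℝ :=
  Real.arccos (metric τ p v w / (√(metric τ p v v) * √(metric τ p w w)))

/-- The curve `γ` makes the constant angle `ϑ` with `E₁` on `I`, and there is a smooth function
`β` on `I` with `γ' = cos ϑ E₁ + sin ϑ sin β E₂ + sin ϑ cos β E₃`. -/
def HasConstantHopfAngle (τ : ℝ) (γ : ℝ → ℂ × ℂ) (I : Set ℝ) (ϑ : ℝ) : Prop :=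
  (∀ s ∈ I, angle τ (γ s) (deriv γ s) (frame τ 0 (γ s)) = ϑ) ∧
  ∃ β : ℝ → ℝ, ContDiffOn ℝ ∞ β I ∧ ∀ s ∈ I,
    deriv γ s = Real.cos ϑ • frame τ 0 (γ s)
      + (Real.sin ϑ * Real.sin (β s)) • frame τ 1 (γ s)
      + (Real.sin ϑ * Real.cos (β s)) • frame τ 2 (γ s)

end SLTau

end

namespace SLTau

/-! Let T₀, T₁, T₂ be the frame components of γ' and w those of the tension field. The point is that
u = T₀ is constant: the horizontal part of γ' then has constant length, and its polar angle lifts to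
a smooth β.

The brackets of the frame have constant coefficients, so w is T' plus a quadratic polynomial in T
(`tension_eq`), and the bienergy depends only on T and T'. Pushing γ along the flow of X₁, X₂ or X₃
for the time tφ(s) gives explicit variations inside the quadric (`FrameFlow`), and these three
families already yield the whole Euler-Lagrange system (`FrameFlow.eulerLagrange`).

For a unit speed curve, the tangential part of the system makes K = |w|² constant, and K ≠ 0 since γ
is not a geodesic. The flow of X₁ is isometric, and its equation integrates to u'' + 2τm = A with m
= T₁w₂ - T₂w₁. The third equation is `normal_equation`. Together with u'² + m² = K(1 - u²) they
overdetermine (u, m): where u' ≠ 0, elimination leaves a polynomial relation whose derivatives force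
m = 0, then A + Ku = 0, hence u' = 0 (`deriv_eq_zero_of_system`). Finally u² < 1, for otherwise γ
would run along the Hopf field and be a geodesic. -/

/-! ### The frame and its Lie brackets -/

lemma isLinearMap_X₁ : IsLinearMap ℝ X₁ := by
  constructor <;> intros <;> simp [X₁, mul_add, mul_left_comm]

lemma isLinearMap_X₂ : IsLinearMap ℝ X₂ := by
  constructor <;> intros <;> simp [X₂, mul_add, mul_left_comm]

lemma isLinearMap_X₃ : IsLinearMap ℝ X₃ := by
  constructor <;> intros <;> simp [X₃]

@[simp] lemma frame_zero (τ : ℝ) (p : ℂ × ℂ) : frame τ 0 p = (-τ⁻¹) • X₁ p := rfl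
@[simp] lemma frame_one (τ : ℝ) (p : ℂ × ℂ) : frame τ 1 p = X₂ p := rfl
@[simp] lemma frame_two (τ : ℝ) (p : ℂ × ℂ) : frame τ 2 p = X₃ p := rfl

lemma isLinearMap_frame (τ : ℝ) (i : Fin 3) : IsLinearMap ℝ (frame τ i) := by
  fin_cases i
  · constructor
    · intro v w; simp [isLinearMap_X₁.map_add]
    · intro r v; simp [isLinearMap_X₁.map_smul, smul_comm r]
  · exact isLinearMap_X₂
  · exact isLinearMap_X₃

lemma lieBracket_of_isLinearMap {E : Type*} [NormedAddCommGroup E] [NormedSpace ℝ E]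
    [FiniteDimensional ℝ E] {V W : E → E} (hV : IsLinearMap ℝ V) (hW : IsLinearMap ℝ W) (p : E) :
    VectorField.lieBracket ℝ V W p = W (V p) - V (W p) := by
  have h : ∀ {V : E → E}, IsLinearMap ℝ V → ∀ v, fderiv ℝ V p v = V v := fun {V} h v => by
    have : V = (LinearMap.toContinuousLinearMap (h.mk' V)) := by ext; rfl
    rw [this, ContinuousLinearMap.fderiv]
  rw [VectorField.lieBracket, h hV, h hW]

lemma lieBracket_frame_zero_one (τ : ℝ) (p : ℂ × ℂ) :
    VectorField.lieBracket ℝ (frame τ 0) (frame τ 1) p = (-(2 * τ⁻¹)) • frame τ 2 p := by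
  rw [lieBracket_of_isLinearMap (isLinearMap_frame τ 0) (isLinearMap_frame τ 1)]
  ext
  · simp [X₁, X₂, X₃]
    linear_combination (2 * (τ : ℂ)⁻¹ * conj p.2) * Complex.I_sq
  · simp [X₁, X₂, X₃]
    linear_combination (2 * (τ : ℂ)⁻¹ * conj p.1) * Complex.I_sq

lemma lieBracket_frame_two_zero (τ : ℝ) (p : ℂ × ℂ) :
    VectorField.lieBracket ℝ (frame τ 2) (frame τ 0) p = (-(2 * τ⁻¹)) • frame τ 1 p := by
  rw [lieBracket_of_isLinearMap (isLinearMap_frame τ 2) (isLinearMap_frame τ 0)]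
  ext <;> simp [X₁, X₂, X₃] <;> ring

lemma lieBracket_frame_one_two {τ : ℝ} (hτ : τ ≠ 0) (p : ℂ × ℂ) :
    VectorField.lieBracket ℝ (frame τ 1) (frame τ 2) p = (2 * τ) • frame τ 0 p := by
  have hτ' : (τ : ℂ) ≠ 0 := by exact_mod_cast hτ
  rw [lieBracket_of_isLinearMap (isLinearMap_frame τ 1) (isLinearMap_frame τ 2)]
  ext <;> simp [X₁, X₂, X₃] <;> field_simp <;> ring

/-! ### The metric and the tension field in the frame -/

lemma pseudoInner_add_left (v v' w : ℂ × ℂ) :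
    pseudoInner (v + v') w = pseudoInner v w + pseudoInner v' w := by
  simp [pseudoInner]; ring

lemma pseudoInner_smul_left (r : ℝ) (v w : ℂ × ℂ) :
    pseudoInner (r • v) w = r * pseudoInner v w := by
  simp [pseudoInner]; ring

lemma metric_comm (τ : ℝ) (p v w : ℂ × ℂ) : metric τ p v w = metric τ p w v := by
  simp [metric, pseudoInner]; ring

lemma metric_add_left (τ : ℝ) (p v v' w : ℂ × ℂ) :
    metric τ p (v + v') w = metric τ p v w + metric τ p v' w := by
  simp only [metric, pseudoInner_add_left]; ring

lemma metric_smul_left (τ r : ℝ) (p v w : ℂ × ℂ) :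
    metric τ p (r • v) w = r * metric τ p v w := by
  simp only [metric, pseudoInner_smul_left]; ring

lemma metric_neg_left (τ : ℝ) (p v w : ℂ × ℂ) :
    metric τ p (-v) w = - metric τ p v w := by
  rw [← neg_one_smul ℝ v, metric_smul_left]; ring

lemma metric_zero_left (τ : ℝ) (p w : ℂ × ℂ) : metric τ p 0 w = 0 := by
  simpa using metric_smul_left τ 0 p 0 w

lemma metric_add_right (τ : ℝ) (p v w w' : ℂ × ℂ) :
    metric τ p v (w + w') = metric τ p v w + metric τ p v w' := by
  rw [metric_comm, metric_add_left, metric_comm τ p w, metric_comm τ p w']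

lemma metric_smul_right (τ r : ℝ) (p v w : ℂ × ℂ) :
    metric τ p v (r • w) = r * metric τ p v w := by
  rw [metric_comm, metric_smul_left, metric_comm]

lemma metric_frame {τ : ℝ} (hτ : τ ≠ 0) {p : ℂ × ℂ} (hp : p ∈ SL2) (i j : Fin 3) :
    metric τ p (frame τ i p) (frame τ j p) = if i = j then 1 else 0 := by
  obtain ⟨⟨a, b⟩, ⟨c, d⟩⟩ := p
  have h : a * a + b * b - (c * c + d * d) = 1 := by simpa [SL2, pseudoInner] using hp
  have h' : a * a = 1 - b * b + (c * c + d * d) := by linear_combination h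
  fin_cases i <;> fin_cases j <;>
    simp [metric, pseudoInner, X₁, X₂, X₃] <;> field_simp <;> simp only [pow_two, mul_add, h'] <;>
    ring

/-- The vectors p, X₁p, X₂p, X₃p are pseudo-orthogonal, with squares q, q, -q, -q for q = ⟨p, p⟩.
Multiplying by q instead of dividing keeps the expansion a polynomial identity valid for every p. -/
lemma pseudoInner_smul_eq (p v : ℂ × ℂ) :
    pseudoInner p p • v = pseudoInner v p • p + pseudoInner v (X₁ p) • X₁ p
      - pseudoInner v (X₂ p) • X₂ p - pseudoInner v (X₃ p) • X₃ p := by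
  obtain ⟨⟨a, b⟩, ⟨c, d⟩⟩ := p
  obtain ⟨⟨e, f⟩, ⟨g, k⟩⟩ := v
  refine Prod.ext (Complex.ext ?_ ?_) (Complex.ext ?_ ?_) <;>
    simp [pseudoInner, X₁, X₂, X₃] <;> ring

lemma eq_sum_frame {τ : ℝ} (hτ : τ ≠ 0) {p v : ℂ × ℂ} (hp : p ∈ SL2) (hv : pseudoInner v p = 0) :
    v = metric τ p v (frame τ 0 p) • frame τ 0 p + metric τ p v (frame τ 1 p) • frame τ 1 p
      + metric τ p v (frame τ 2 p) • frame τ 2 p := by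
  have hp' : pseudoInner p p = 1 := hp
  have h := pseudoInner_smul_eq p v
  rw [hp', hv, one_smul, zero_smul, zero_add] at h
  have h1 : pseudoInner (X₁ p) (X₁ p) = 1 := by
    rw [← hp']; simp [pseudoInner, X₁]
  have h2 : pseudoInner (X₂ p) (X₁ p) = 0 := by
    simp [pseudoInner, X₁, X₂]; ring
  have h3 : pseudoInner (X₃ p) (X₁ p) = 0 := by
    simp [pseudoInner, X₁, X₃]; ring
  have e0 : metric τ p v (frame τ 0 p) = -τ * pseudoInner v (X₁ p) := by
    rw [metric_comm, frame_zero, metric_smul_left, metric_comm]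
    simp only [metric, h1]; field_simp; ring
  have e1 : metric τ p v (frame τ 1 p) = - pseudoInner v (X₂ p) := by
    simp [metric, h2]
  have e2 : metric τ p v (frame τ 2 p) = - pseudoInner v (X₃ p) := by
    simp [metric, h3]
  rw [e0, e1, e2, frame_zero, frame_one, frame_two, smul_smul]
  have : -τ * pseudoInner v (X₁ p) * -τ⁻¹ = pseudoInner v (X₁ p) := by field_simp
  rw [this, neg_smul, neg_smul, ← sub_eq_add_neg, ← sub_eq_add_neg]
  exact h

lemma metric_comb {τ : ℝ} (hτ : τ ≠ 0) {p : ℂ × ℂ} (hp : p ∈ SL2) (r s t : ℝ) :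
    metric τ p (r • frame τ 0 p + s • frame τ 1 p + t • frame τ 2 p)
      (r • frame τ 0 p + s • frame τ 1 p + t • frame τ 2 p) = r ^ 2 + s ^ 2 + t ^ 2 := by
  simp only [metric_add_left, metric_add_right, metric_smul_left, metric_smul_right,
    metric_frame hτ hp]
  simp; ring

/-- The component along `E_k` of the velocity of a curve. -/
noncomputable def velocity (τ : ℝ) (c : ℝ → ℂ × ℂ) (k : Fin 3) (s : ℝ) : ℝ :=
  metric τ (c s) (deriv c s) (frame τ k (c s))

/-- Only the part of the connection symmetric in its two lower slots enters ∇_T T. By Koszul, the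
quadratic term along E_k is ∑ T_i T_j g([E_k, E_i], E_j). It vanishes for k = 0 because ad E₀ is
skew; the two mixed brackets add up to 2(τ + τ⁻¹) otherwise. -/
lemma tension_eq {τ : ℝ} (hτ : τ ≠ 0) (c : ℝ → ℂ × ℂ) {s : ℝ} (hs : c s ∈ SL2) :
    tension τ c s = deriv (velocity τ c 0) s • frame τ 0 (c s)
      + (deriv (velocity τ c 1) s + 2 * (τ + τ⁻¹) * velocity τ c 0 s * velocity τ c 2 s)
        • frame τ 1 (c s)
      + (deriv (velocity τ c 2) s - 2 * (τ + τ⁻¹) * velocity τ c 0 s * velocity τ c 1 s)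
        • frame τ 2 (c s) := by
  have h10 : VectorField.lieBracket ℝ (frame τ 1) (frame τ 0) (c s) = (2 * τ⁻¹) • frame τ 2 (c s) := by
    rw [VectorField.lieBracket_swap, lieBracket_frame_zero_one, neg_smul, neg_neg]
  have h02 : VectorField.lieBracket ℝ (frame τ 0) (frame τ 2) (c s) = (2 * τ⁻¹) • frame τ 1 (c s) := by
    rw [VectorField.lieBracket_swap, lieBracket_frame_two_zero, neg_smul, neg_neg]
  have h21 : VectorField.lieBracket ℝ (frame τ 2) (frame τ 1) (c s) = (-(2 * τ)) • frame τ 0 (c s) := by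
    rw [VectorField.lieBracket_swap, lieBracket_frame_one_two hτ, neg_smul]
  have hs' : ∀ i, VectorField.lieBracket ℝ (frame τ i) (frame τ i) (c s) = 0 := by
    intro i; simp [VectorField.lieBracket]
  have hv : ∀ k, (fun r => metric τ (c r) (deriv c r) (frame τ k (c r))) = velocity τ c k :=
    fun k => rfl
  have hv' : ∀ k, metric τ (c s) (deriv c s) (frame τ k (c s)) = velocity τ c k s := fun k => rfl
  have h0 : ∀ w, metric τ (c s) 0 w = 0 := metric_zero_left τ (c s)
  unfold tension covDeriv
  simp only [hv, hv', connectionCoeff, Fin.sum_univ_three, lieBracket_frame_zero_one,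
    lieBracket_frame_two_zero, lieBracket_frame_one_two hτ, h10, h02, h21, hs', metric_smul_left,
    metric_frame hτ hs, h0]
  simp only [Fin.isValue, ↓reduceIte, Fin.reduceEq, mul_one, mul_zero, add_zero, zero_add,
    sub_self]
  congr 1
  · congr 1
    · congr 1; ring
    · congr 1; ring
  · congr 1; ring

lemma metric_tension {τ : ℝ} (hτ : τ ≠ 0) (c : ℝ → ℂ × ℂ) {s : ℝ} (hs : c s ∈ SL2) :
    metric τ (c s) (tension τ c s) (tension τ c s) = deriv (velocity τ c 0) s ^ 2
      + (deriv (velocity τ c 1) s + 2 * (τ + τ⁻¹) * velocity τ c 0 s * velocity τ c 2 s) ^ 2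
      + (deriv (velocity τ c 2) s - 2 * (τ + τ⁻¹) * velocity τ c 0 s * velocity τ c 1 s) ^ 2 := by
  rw [tension_eq hτ c hs, metric_comb hτ hs]

/-! ### Differentiation under the integral and the fundamental lemma of the calculus of variations
-/

open MeasureTheory Topology in
lemma hasDerivAt_intervalIntegral_of_contDiffOn {F : ℝ → ℝ → ℝ} {F' : ℝ → ℝ} {ε a b : ℝ}
    {I : Set ℝ} (hI : IsOpen I) (hε : 0 < ε) (hab : a ≤ b) (habI : Icc a b ⊆ I)
    (hF : ContDiffOn ℝ 1 (fun q : ℝ × ℝ => F q.1 q.2) (Ioo (-ε) ε ×ˢ I))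
    (hF' : ∀ s ∈ Icc a b, HasDerivAt (fun t => F t s) (F' s) 0) :
    HasDerivAt (fun t => ∫ s in a..b, F t s) (∫ s in a..b, F' s) 0 := by
  set f : ℝ × ℝ → ℝ := fun q => F q.1 q.2 with hf
  have hU : IsOpen (Ioo (-ε) ε ×ˢ I) := isOpen_Ioo.prod hI
  have hpart : ∀ t ∈ Ioo (-ε) ε, ∀ s ∈ I,
      HasDerivAt (fun t => F t s) (fderiv ℝ f (t, s) (1, 0)) t := by
    intro t ht s hs
    have h1 : HasFDerivAt f (fderiv ℝ f (t, s)) (t, s) :=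
      ((hF.differentiableOn (by simp)) (t, s) ⟨ht, hs⟩).differentiableAt
        (hU.mem_nhds ⟨ht, hs⟩) |>.hasFDerivAt
    exact h1.comp_hasDerivAt t ((hasDerivAt_id t).prodMk (hasDerivAt_const t s))
  have hcont : ContinuousOn (fun q => fderiv ℝ f q (1, 0)) (Ioo (-ε) ε ×ˢ I) :=
    (hF.continuousOn_fderiv_of_isOpen hU le_rfl).clm_apply continuousOn_const
  -- Halving ε gives a compact rectangle, on which the continuous t-derivative has the constant
  -- bound that dominated convergence needs.
  have hsub : Icc (-(ε / 2)) (ε / 2) ×ˢ Icc a b ⊆ Ioo (-ε) ε ×ˢ I := by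
    refine prod_mono (fun t ht => ⟨?_, ?_⟩) habI <;> linarith [ht.1, ht.2]
  obtain ⟨C, hC⟩ := (isCompact_Icc.prod isCompact_Icc).exists_bound_of_continuousOn
    (hcont.mono hsub)
  have hmem : ∀ s, s ∈ uIoc a b → s ∈ Icc a b := fun s hs => by
    rw [uIoc_of_le hab] at hs; exact Ioc_subset_Icc_self hs
  have h0 : (0 : ℝ) ∈ Ioo (-ε) ε := ⟨by linarith, hε⟩
  have hslice : ∀ t ∈ Ioo (-ε) ε, ContinuousOn (fun s => ((t, s) : ℝ × ℝ)) I ∧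
      MapsTo (fun s => ((t, s) : ℝ × ℝ)) I (Ioo (-ε) ε ×ˢ I) := fun t ht =>
    ⟨by fun_prop, fun s hs => ⟨ht, hs⟩⟩
  have hFc : ∀ t ∈ Ioo (-ε) ε, ContinuousOn (F t) (uIcc a b) := fun t ht => by
    rw [uIcc_of_le hab]
    exact (hF.continuousOn.comp (hslice t ht).1 (hslice t ht).2).mono habI
  have hF'c : ContinuousOn (fun s => fderiv ℝ f (0, s) (1, 0)) (uIcc a b) := by
    rw [uIcc_of_le hab]
    exact (hcont.comp (hslice 0 h0).1 (hslice 0 h0).2).mono habI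
  have key := intervalIntegral.hasDerivAt_integral_of_dominated_loc_of_deriv_le
    (μ := volume) (F := F) (F' := fun t s => fderiv ℝ f (t, s) (1, 0)) (x₀ := (0 : ℝ))
    (s := Ioo (-(ε / 2)) (ε / 2)) (a := a) (b := b) (bound := fun _ : ℝ => C)
    (Ioo_mem_nhds (by linarith) (by linarith))
    (by
      filter_upwards [Ioo_mem_nhds h0.1 h0.2] with t ht
      exact (hFc t ht).intervalIntegrable.def'.aestronglyMeasurable)
    (hFc 0 h0).intervalIntegrable hF'c.intervalIntegrable.def'.aestronglyMeasurable
    (Filter.Eventually.of_forall fun (s : ℝ) hs t ht => hC (t, s) ⟨Ioo_subset_Icc_self ht, hmem s hs⟩)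
    (intervalIntegrable_const (c := C))
    (Filter.Eventually.of_forall fun (s : ℝ) hs t ht =>
      hpart t ⟨by linarith [ht.1], by linarith [ht.2]⟩ s (habI (hmem s hs)))
  have heq : ∫ s in a..b, F' s = ∫ s in a..b, fderiv ℝ f (0, s) (1, 0) := by
    apply intervalIntegral.integral_congr
    intro s hs
    rw [uIcc_of_le hab] at hs
    exact (hF' s hs).unique (hpart 0 h0 s (habI hs))
  rw [heq]
  exact key.2

open MeasureTheory in
-- Two integrations by parts for f and one for g move all derivatives off φ. No boundary terms
-- arise, since φ and φ' vanish at a and b. The resulting expression is zero almost everywhere, and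
-- continuity makes it zero everywhere.
lemma eulerLagrange_of_integral_eq_zero {a b : ℝ} (hab : a < b) {f f' f'' g g' h : ℝ → ℝ}
    (hf : ∀ s ∈ Icc a b, HasDerivAt f (f' s) s) (hf' : ∀ s ∈ Icc a b, HasDerivAt f' (f'' s) s)
    (hg : ∀ s ∈ Icc a b, HasDerivAt g (g' s) s) (hf'' : ContinuousOn f'' (Icc a b))
    (hg' : ContinuousOn g' (Icc a b)) (hh : ContinuousOn h (Icc a b))
    (H : ∀ φ : ℝ → ℝ, ContDiff ℝ ∞ φ → tsupport φ ⊆ Ioo a b →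
      ∫ s in a..b, (f s * deriv (deriv φ) s + g s * deriv φ s + h s * φ s) = 0)
    {s : ℝ} (hs : s ∈ Ioo a b) : f'' s - g' s + h s = 0 := by
  have hu : uIcc a b = Icc a b := uIcc_of_le hab.le
  have hcf : ContinuousOn f (Icc a b) := fun s hs => (hf s hs).continuousAt.continuousWithinAt
  have hcf' : ContinuousOn f' (Icc a b) := fun s hs => (hf' s hs).continuousAt.continuousWithinAt
  have hcg : ContinuousOn g (Icc a b) := fun s hs => (hg s hs).continuousAt.continuousWithinAt
  have hcont : ContinuousOn (fun s => f'' s - g' s + h s) (Icc a b) := (hf''.sub hg').add hh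
  have hweak : ∀ φ : ℝ → ℝ, ContDiff ℝ ∞ φ → HasCompactSupport φ → tsupport φ ⊆ Ioo a b →
      ∫ s, φ s • (f'' s - g' s + h s) = 0 := by
    intro φ hφ _ hsupp
    have hφ1 : ContDiff ℝ ∞ (deriv φ) := by
      have := hφ.iterate_deriv 1; simpa using this
    have hφ2 : ContDiff ℝ ∞ (deriv (deriv φ)) := by
      have := hφ1.iterate_deriv 1; simpa using this
    have hd0 : ∀ s, HasDerivAt φ (deriv φ s) s := fun s =>
      (hφ.differentiable (by simp) s).hasDerivAt
    have hd1 : ∀ s, HasDerivAt (deriv φ) (deriv (deriv φ) s) s := fun s =>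
      (hφ1.differentiable (by simp) s).hasDerivAt
    have hz : ∀ s ∉ Ioo a b, φ s = 0 := fun s hs => image_eq_zero_of_notMem_tsupport
      (fun h => hs (hsupp h))
    have hz1 : ∀ s ∉ Ioo a b, deriv φ s = 0 := fun s hs => by
      have : s ∉ tsupport (deriv φ) := fun h => hs (hsupp (tsupport_deriv_subset h))
      exact image_eq_zero_of_notMem_tsupport this
    have ha : a ∉ Ioo a b := by simp
    have hb : b ∉ Ioo a b := by simp
    have i1 := intervalIntegral.integral_mul_deriv_eq_deriv_mul (a := a) (b := b) (u := f)
      (v := deriv φ) (u' := f') (v' := deriv (deriv φ)) (fun s hs => hf s (hu ▸ hs))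
      (fun s _ => hd1 s) (by rw [← hu] at hcf'; exact hcf'.intervalIntegrable)
      (hφ2.continuous.intervalIntegrable _ _)
    have i2 := intervalIntegral.integral_mul_deriv_eq_deriv_mul (a := a) (b := b) (u := f')
      (v := φ) (u' := f'') (v' := deriv φ) (fun s hs => hf' s (hu ▸ hs))
      (fun s _ => hd0 s) (by rw [← hu] at hf''; exact hf''.intervalIntegrable)
      (hφ1.continuous.intervalIntegrable _ _)
    have i3 := intervalIntegral.integral_mul_deriv_eq_deriv_mul (a := a) (b := b) (u := g)
      (v := φ) (u' := g') (v' := deriv φ) (fun s hs => hg s (hu ▸ hs))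
      (fun s _ => hd0 s) (by rw [← hu] at hg'; exact hg'.intervalIntegrable)
      (hφ1.continuous.intervalIntegrable _ _)
    simp only [hz a ha, hz b hb, hz1 a ha, hz1 b hb, mul_zero, sub_zero, zero_sub] at i1 i2 i3
    have hint : ∀ {k l : ℝ → ℝ}, ContinuousOn k (Icc a b) → Continuous l →
        IntervalIntegrable (fun s => k s * l s) volume a b := fun hk hl => by
      rw [← hu] at hk; exact (hk.mul hl.continuousOn).intervalIntegrable
    have h1 := H φ hφ hsupp
    rw [intervalIntegral.integral_add ((hint hcf hφ2.continuous).add (hint hcg hφ1.continuous))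
        (hint hh hφ.continuous), intervalIntegral.integral_add (hint hcf hφ2.continuous)
        (hint hcg hφ1.continuous), i1, i2, i3] at h1
    have h2 : ∫ s in a..b, φ s • (f'' s - g' s + h s) = 0 := by
      have : (fun s => φ s • (f'' s - g' s + h s))
          = fun s => (f'' s * φ s - g' s * φ s) + h s * φ s := by
        funext s; simp only [smul_eq_mul]; ring
      rw [this, intervalIntegral.integral_add
        ((hint hf'' hφ.continuous).sub (hint hg' hφ.continuous)) (hint hh hφ.continuous),
        intervalIntegral.integral_sub (hint hf'' hφ.continuous) (hint hg' hφ.continuous)]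
      linarith
    rw [← h2, intervalIntegral.integral_of_le hab.le,
      setIntegral_eq_integral_of_forall_compl_eq_zero]
    intro s hs
    rw [hz s (fun h => hs (Ioo_subset_Ioc_self h)), zero_smul]
  have hae := isOpen_Ioo.ae_eq_zero_of_integral_contDiff_smul_eq_zero (μ := volume)
    ((hcont.mono Ioo_subset_Icc_self).locallyIntegrableOn measurableSet_Ioo) hweak
  rw [← ae_restrict_iff' measurableSet_Ioo] at hae
  exact Measure.eqOn_open_of_ae_eq (f := fun s => f'' s - g' s + h s) (g := fun _ => (0 : ℝ)) hae
    isOpen_Ioo (hcont.mono Ioo_subset_Icc_self) continuousOn_const hs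

/-! ### Smoothness and frame components of the velocity -/

lemma contDiff_of_isLinearMap {E : Type*} [NormedAddCommGroup E] [NormedSpace ℝ E]
    [FiniteDimensional ℝ E] {V : E → E} (hV : IsLinearMap ℝ V) : ContDiff ℝ ∞ V :=
  (LinearMap.toContinuousLinearMap (hV.mk' V)).contDiff

lemma contDiffOn_pseudoInner {v w : ℝ → ℂ × ℂ} {I : Set ℝ} (hv : ContDiffOn ℝ ∞ v I)
    (hw : ContDiffOn ℝ ∞ w I) : ContDiffOn ℝ ∞ (fun s => pseudoInner (v s) (w s)) I := by
  have hre : ∀ {f : ℝ → ℂ}, ContDiffOn ℝ ∞ f I → ContDiffOn ℝ ∞ (fun s => (f s).re) I :=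
    fun hf => Complex.reCLM.contDiff.comp_contDiffOn hf
  have him : ∀ {f : ℝ → ℂ}, ContDiffOn ℝ ∞ f I → ContDiffOn ℝ ∞ (fun s => (f s).im) I :=
    fun hf => Complex.imCLM.contDiff.comp_contDiffOn hf
  have h1 := hv.fst
  have h2 := hv.snd
  have h3 := hw.fst
  have h4 := hw.snd
  have : (fun s => pseudoInner (v s) (w s)) = fun s =>
      ((v s).1.re * (w s).1.re + (v s).1.im * (w s).1.im)
      - ((v s).2.re * (w s).2.re + (v s).2.im * (w s).2.im) := by
    funext s; simp [pseudoInner]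
  rw [this]
  exact (((hre h1).mul (hre h3)).add ((him h1).mul (him h3))).sub
    (((hre h2).mul (hre h4)).add ((him h2).mul (him h4)))

lemma contDiffOn_velocity (τ : ℝ) {c : ℝ → ℂ × ℂ} {I : Set ℝ} (hI : IsOpen I)
    (hc : ContDiffOn ℝ ∞ c I) (k : Fin 3) : ContDiffOn ℝ ∞ (velocity τ c k) I := by
  have hc' : ContDiffOn ℝ ∞ (deriv c) I := hc.deriv_of_isOpen hI (by simp)
  have hX : ContDiffOn ℝ ∞ (fun s => X₁ (c s)) I :=
    (contDiff_of_isLinearMap isLinearMap_X₁).comp_contDiffOn hc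
  have hE : ContDiffOn ℝ ∞ (fun s => frame τ k (c s)) I :=
    (contDiff_of_isLinearMap (isLinearMap_frame τ k)).comp_contDiffOn hc
  exact (contDiffOn_pseudoInner hc' hE).neg.add
    ((contDiffOn_const.mul (contDiffOn_pseudoInner hc' hX)).mul (contDiffOn_pseudoInner hE hX))

lemma metric_sum_frame {τ : ℝ} (hτ : τ ≠ 0) {p : ℂ × ℂ} (hp : p ∈ SL2) (a : Fin 3 → ℝ)
    (i : Fin 3) : metric τ p (∑ k, a k • frame τ k p) (frame τ i p) = a i := by
  simp only [Fin.sum_univ_three, metric_add_left, metric_smul_left, metric_frame hτ hp]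
  fin_cases i <;> simp

lemma velocity_eq_of_deriv_eq {τ : ℝ} (hτ : τ ≠ 0) {c : ℝ → ℂ × ℂ} {s : ℝ} (hs : c s ∈ SL2)
    {a : Fin 3 → ℝ} (h : deriv c s = ∑ k, a k • frame τ k (c s)) (i : Fin 3) :
    velocity τ c i s = a i := by
  rw [velocity, h, metric_sum_frame hτ hs]

/-- Differentiating |z|² - |w|² = 1 along the curve shows that the velocity is tangent to the
quadric, so the frame spans it. -/
lemma deriv_eq_sum_velocity {τ : ℝ} (hτ : τ ≠ 0) {c : ℝ → ℂ × ℂ} {I : Set ℝ} (hI : IsOpen I)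
    (hc : ContDiffOn ℝ ∞ c I) (hSL : ∀ s ∈ I, c s ∈ SL2) {s : ℝ} (hs : s ∈ I) :
    deriv c s = ∑ k, velocity τ c k s • frame τ k (c s) := by
  have hd : HasDerivAt c (deriv c s) s :=
    ((hc.differentiableOn (by simp)).differentiableAt (hI.mem_nhds hs)).hasDerivAt
  have h1 := Complex.reCLM.hasFDerivAt.comp_hasDerivAt s hd.fst
  have h2 := Complex.imCLM.hasFDerivAt.comp_hasDerivAt s hd.fst
  have h3 := Complex.reCLM.hasFDerivAt.comp_hasDerivAt s hd.snd
  have h4 := Complex.imCLM.hasFDerivAt.comp_hasDerivAt s hd.snd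
  have h5 := ((h1.mul h1).add (h2.mul h2)).sub ((h3.mul h3).add (h4.mul h4))
  have h6 : HasDerivAt (fun _ : ℝ => (1 : ℝ)) _ s := h5.congr_of_eventuallyEq (by
    filter_upwards [hI.mem_nhds hs] with r hr
    have := hSL r hr
    simp only [SL2, pseudoInner, mem_ofPred_eq, Complex.mul_re, Complex.conj_re,
      Complex.conj_im] at this
    simp
    linarith)
  have h7 := h6.unique (hasDerivAt_const s 1)
  rw [Fin.sum_univ_three]
  refine eq_sum_frame hτ (hSL s hs) ?_
  simp at h7
  simp [pseudoInner]
  linarith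

/-! ### Flows of the frame fields -/

/-- The action of the flow `cf θ + sf θ A` of a linear field `A = ∑ α_k E_k` with `A ∘ A = σ` on
the frame `E_k`, where `ρ` is the derivative at `0` of the transition matrix `R`. -/
structure FrameFlow (τ : ℝ) (A : ℂ × ℂ → ℂ × ℂ) (σ : ℝ) (cf sf : ℝ → ℝ) (α : Fin 3 → ℝ)
    (R : ℝ → Fin 3 → Fin 3 → ℝ) (ρ : Fin 3 → Fin 3 → ℝ) : Prop where
  linear : IsLinearMap ℝ A
  apply_apply : ∀ p, A (A p) = σ • p
  inner_self : ∀ p, pseudoInner p (A p) = 0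
  inner_apply : ∀ p, pseudoInner (A p) (A p) = -σ * pseudoInner p p
  contDiff_cf : ContDiff ℝ ∞ cf
  contDiff_sf : ContDiff ℝ ∞ sf
  hasDerivAt_cf : ∀ θ, HasDerivAt cf (σ * sf θ) θ
  hasDerivAt_sf : ∀ θ, HasDerivAt sf (cf θ) θ
  cf_zero : cf 0 = 1
  sf_zero : sf 0 = 0
  sq_sub_sq : ∀ θ, cf θ ^ 2 - σ * sf θ ^ 2 = 1
  apply_eq : ∀ p, A p = ∑ k, α k • frame τ k p
  flow_frame : ∀ θ j p, cf θ • frame τ j p + sf θ • A (frame τ j p)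
    = ∑ k, R θ k j • frame τ k (cf θ • p + sf θ • A p)
  contDiff_R : ∀ k j, ContDiff ℝ ∞ (fun θ => R θ k j)
  R_zero : ∀ k j, R 0 k j = if k = j then 1 else 0
  hasDerivAt_R : ∀ k j, HasDerivAt (fun θ => R θ k j) (ρ k j) 0

lemma sl2_of_sq_sub_sq {A : ℂ × ℂ → ℂ × ℂ} {σ : ℝ} (hA : ∀ p, pseudoInner p (A p) = 0)
    (hAA : ∀ p, pseudoInner (A p) (A p) = -σ * pseudoInner p p) {a b : ℝ}
    (hab : a ^ 2 - σ * b ^ 2 = 1) {p : ℂ × ℂ} (hp : p ∈ SL2) : a • p + b • A p ∈ SL2 := by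
  have hp' : pseudoInner p p = 1 := hp
  have h1 := hA p
  have h2 := hAA p
  rw [hp'] at h2
  have : pseudoInner (a • p + b • A p) (a • p + b • A p) = a ^ 2 * pseudoInner p p
      + 2 * (a * b) * pseudoInner p (A p) + b ^ 2 * pseudoInner (A p) (A p) := by
    simp [pseudoInner]; ring
  show pseudoInner _ _ = 1
  rw [this, hp', h1, h2]
  linarith

/-- The velocity of the moved curve has two sources: the old velocity pushed forward by the flow,
which acts on components by R, and the changing flow time, which contributes θ' times the generator
A. -/
lemma FrameFlow.hasDerivAt_flow {τ σ : ℝ} {A : ℂ × ℂ → ℂ × ℂ} {cf sf : ℝ → ℝ} {α : Fin 3 → ℝ}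
    {R : ℝ → Fin 3 → Fin 3 → ℝ} {ρ : Fin 3 → Fin 3 → ℝ} (hA : FrameFlow τ A σ cf sf α R ρ)
    {c : ℝ → ℂ × ℂ} {θ : ℝ → ℝ} {s θ' : ℝ} {a : Fin 3 → ℝ}
    (hc : HasDerivAt c (∑ k, a k • frame τ k (c s)) s) (hθ : HasDerivAt θ θ' s) :
    HasDerivAt (fun r => cf (θ r) • c r + sf (θ r) • A (c r))
      (∑ k, (∑ j, R (θ s) k j * a j + θ' * α k)
        • frame τ k (cf (θ s) • c s + sf (θ s) • A (c s))) s := by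
  have hAd : HasDerivAt (fun r => A (c r)) (A (∑ k, a k • frame τ k (c s))) s :=
    (LinearMap.toContinuousLinearMap (hA.linear.mk' A)).hasFDerivAt.comp_hasDerivAt s hc
  have h := (((hA.hasDerivAt_cf (θ s)).comp s hθ).smul hc).add
    (((hA.hasDerivAt_sf (θ s)).comp s hθ).smul hAd)
  refine h.congr_deriv ?_
  have hfl : ∀ v : ℂ × ℂ, A v = hA.linear.mk' A v := fun v => rfl
  have e1 : ∑ k, (∑ j, R (θ s) k j * a j + θ' * α k)
        • frame τ k (cf (θ s) • c s + sf (θ s) • A (c s))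
      = ∑ j, a j • (cf (θ s) • frame τ j (c s) + sf (θ s) • A (frame τ j (c s)))
        + θ' • A (cf (θ s) • c s + sf (θ s) • A (c s)) := by
    rw [hA.apply_eq (cf (θ s) • c s + sf (θ s) • A (c s))]
    simp only [hA.flow_frame, Fin.sum_univ_three]
    module
  have e2 : A (cf (θ s) • c s + sf (θ s) • A (c s)) = cf (θ s) • A (c s) + (sf (θ s) * σ) • c s := by
    rw [hA.linear.map_add, hA.linear.map_smul, hA.linear.map_smul, hA.apply_apply, smul_smul]
  have e3 : A (∑ k, a k • frame τ k (c s)) = ∑ k, a k • A (frame τ k (c s)) := by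
    rw [hfl, map_sum]
    simp only [map_smul]
    rfl
  rw [e1, e2, e3]
  simp only [Fin.sum_univ_three, Function.comp]
  module

/-- Since the brackets are constant, the flow transforms the frame by a one-parameter group of
matrices, whose generator ρ is -ad A. Here it rotates the horizontal plane, so this flow is
isometric; for X₂ and X₃ it is a hyperbolic rotation mixing E₀ with a horizontal direction. -/
lemma frameFlow_X₁ {τ : ℝ} (hτ : τ ≠ 0) :
    FrameFlow τ X₁ (-1) Real.cos Real.sin ![-τ, 0, 0]
      (fun θ => ![![1, 0, 0], ![0, Real.cos (2 * θ), Real.sin (2 * θ)],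
        ![0, -Real.sin (2 * θ), Real.cos (2 * θ)]])
      ![![0, 0, 0], ![0, 0, 2], ![0, -2, 0]] where
  linear := isLinearMap_X₁
  apply_apply p := by ext <;> simp [X₁, ← mul_assoc]
  inner_self p := by simp [pseudoInner, X₁]; ring
  inner_apply p := by simp [pseudoInner, X₁]
  contDiff_cf := Real.contDiff_cos
  contDiff_sf := Real.contDiff_sin
  hasDerivAt_cf θ := by simpa using Real.hasDerivAt_cos θ
  hasDerivAt_sf := Real.hasDerivAt_sin
  cf_zero := Real.cos_zero
  sf_zero := Real.sin_zero
  sq_sub_sq θ := by linear_combination Real.cos_sq_add_sin_sq θ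
  apply_eq p := by simp [Fin.sum_univ_three, smul_smul, hτ]
  flow_frame θ j p := by
    have h := Real.cos_sq_add_sin_sq θ
    have hD := Real.cos_two_mul' θ
    have hE := Real.sin_two_mul θ
    generalize Real.cos (2 * θ) = D at hD ⊢
    generalize Real.sin (2 * θ) = E at hE ⊢
    generalize Real.cos θ = C at h hD hE ⊢
    generalize Real.sin θ = S at h hD hE ⊢
    obtain ⟨⟨a, b⟩, ⟨c, d⟩⟩ := p
    fin_cases j <;> refine Prod.ext (Complex.ext ?_ ?_) (Complex.ext ?_ ?_) <;>
      simp [Fin.sum_univ_three, X₁, X₂, X₃] <;> grind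
  contDiff_R k j := by fin_cases k <;> fin_cases j <;> simp <;> fun_prop
  R_zero k j := by fin_cases k <;> fin_cases j <;> simp
  hasDerivAt_R k j := by
    have h2 : HasDerivAt (fun θ : ℝ => 2 * θ) 2 0 := by
      simpa using (hasDerivAt_id (0 : ℝ)).const_mul 2
    have hc : HasDerivAt (fun θ : ℝ => Real.cos (2 * θ)) 0 0 := by simpa using h2.cos
    have hs : HasDerivAt (fun θ : ℝ => Real.sin (2 * θ)) 2 0 := by simpa using h2.sin
    fin_cases k <;> fin_cases j <;> simp [hasDerivAt_const, hc, hs]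
    exact hs.neg

lemma frameFlow_X₂ {τ : ℝ} (hτ : τ ≠ 0) :
    FrameFlow τ X₂ 1 Real.cosh Real.sinh ![0, 1, 0]
      (fun θ => ![![Real.cosh (2 * θ), 0, -τ * Real.sinh (2 * θ)], ![0, 1, 0],
        ![-τ⁻¹ * Real.sinh (2 * θ), 0, Real.cosh (2 * θ)]])
      ![![0, 0, -(2 * τ)], ![0, 0, 0], ![-(2 * τ⁻¹), 0, 0]] where
  linear := isLinearMap_X₂
  apply_apply p := by ext <;> simp [X₂, ← mul_assoc]
  inner_self p := by simp [pseudoInner, X₂]; ring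
  inner_apply p := by simp [pseudoInner, X₂]
  contDiff_cf := Real.contDiff_cosh
  contDiff_sf := Real.contDiff_sinh
  hasDerivAt_cf θ := by simpa using Real.hasDerivAt_cosh θ
  hasDerivAt_sf := Real.hasDerivAt_sinh
  cf_zero := Real.cosh_zero
  sf_zero := Real.sinh_zero
  sq_sub_sq θ := by linear_combination Real.cosh_sq_sub_sinh_sq θ
  apply_eq p := by simp [Fin.sum_univ_three]
  flow_frame θ j p := by
    have h := Real.cosh_sq_sub_sinh_sq θ
    have hD := Real.cosh_two_mul θ
    have hE := Real.sinh_two_mul θ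
    generalize Real.cosh (2 * θ) = D at hD ⊢
    generalize Real.sinh (2 * θ) = E at hE ⊢
    generalize Real.cosh θ = C at h hD hE ⊢
    generalize Real.sinh θ = S at h hD hE ⊢
    obtain ⟨⟨a, b⟩, ⟨c, d⟩⟩ := p
    fin_cases j <;> refine Prod.ext (Complex.ext ?_ ?_) (Complex.ext ?_ ?_) <;>
      simp [Fin.sum_univ_three, X₁, X₂, X₃] <;> grind
  contDiff_R k j := by
    fin_cases k <;> fin_cases j <;> simp <;> fun_prop
  R_zero k j := by fin_cases k <;> fin_cases j <;> simp
  hasDerivAt_R k j := by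
    have h2 : HasDerivAt (fun θ : ℝ => 2 * θ) 2 0 := by
      simpa using (hasDerivAt_id (0 : ℝ)).const_mul 2
    have hc : HasDerivAt (fun θ : ℝ => Real.cosh (2 * θ)) 0 0 := by simpa using h2.cosh
    have hs : HasDerivAt (fun θ : ℝ => Real.sinh (2 * θ)) 2 0 := by simpa using h2.sinh
    have h1 := (hs.const_mul τ).neg
    have h1' := (hs.const_mul τ⁻¹).neg
    rw [mul_comm] at h1 h1'
    fin_cases k <;> fin_cases j <;> simp [hasDerivAt_const, hc]
    exacts [h1, h1']

lemma frameFlow_X₃ {τ : ℝ} (hτ : τ ≠ 0) :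
    FrameFlow τ X₃ 1 Real.cosh Real.sinh ![0, 0, 1]
      (fun θ => ![![Real.cosh (2 * θ), τ * Real.sinh (2 * θ), 0],
        ![τ⁻¹ * Real.sinh (2 * θ), Real.cosh (2 * θ), 0], ![0, 0, 1]])
      ![![0, 2 * τ, 0], ![2 * τ⁻¹, 0, 0], ![0, 0, 0]] where
  linear := isLinearMap_X₃
  apply_apply p := by ext <;> simp [X₃]
  inner_self p := by simp [pseudoInner, X₃]; ring
  inner_apply p := by simp [pseudoInner, X₃]
  contDiff_cf := Real.contDiff_cosh
  contDiff_sf := Real.contDiff_sinh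
  hasDerivAt_cf θ := by simpa using Real.hasDerivAt_cosh θ
  hasDerivAt_sf := Real.hasDerivAt_sinh
  cf_zero := Real.cosh_zero
  sf_zero := Real.sinh_zero
  sq_sub_sq θ := by linear_combination Real.cosh_sq_sub_sinh_sq θ
  apply_eq p := by simp [Fin.sum_univ_three]
  flow_frame θ j p := by
    have h := Real.cosh_sq_sub_sinh_sq θ
    have hD := Real.cosh_two_mul θ
    have hE := Real.sinh_two_mul θ
    generalize Real.cosh (2 * θ) = D at hD ⊢
    generalize Real.sinh (2 * θ) = E at hE ⊢
    generalize Real.cosh θ = C at h hD hE ⊢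
    generalize Real.sinh θ = S at h hD hE ⊢
    obtain ⟨⟨a, b⟩, ⟨c, d⟩⟩ := p
    fin_cases j <;> refine Prod.ext (Complex.ext ?_ ?_) (Complex.ext ?_ ?_) <;>
      simp [Fin.sum_univ_three, X₁, X₂, X₃] <;> grind
  contDiff_R k j := by
    fin_cases k <;> fin_cases j <;> simp <;> fun_prop
  R_zero k j := by fin_cases k <;> fin_cases j <;> simp
  hasDerivAt_R k j := by
    have h2 : HasDerivAt (fun θ : ℝ => 2 * θ) 2 0 := by
      simpa using (hasDerivAt_id (0 : ℝ)).const_mul 2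
    have hc : HasDerivAt (fun θ : ℝ => Real.cosh (2 * θ)) 0 0 := by simpa using h2.cosh
    have hs : HasDerivAt (fun θ : ℝ => Real.sinh (2 * θ)) 2 0 := by simpa using h2.sinh
    have h1 := hs.const_mul τ
    have h1' := hs.const_mul τ⁻¹
    rw [mul_comm] at h1 h1'
    fin_cases k <;> fin_cases j <;> simp [hasDerivAt_const, hc]
    exacts [h1, h1']

/-! ### First variation of the bienergy -/

/-- The component along `E_k` of the tension field of a curve. -/
noncomputable def tensionComp (τ : ℝ) (c : ℝ → ℂ × ℂ) (k : Fin 3) (s : ℝ) : ℝ :=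
  ![deriv (velocity τ c 0) s,
    deriv (velocity τ c 1) s + 2 * (τ + τ⁻¹) * velocity τ c 0 s * velocity τ c 2 s,
    deriv (velocity τ c 2) s - 2 * (τ + τ⁻¹) * velocity τ c 0 s * velocity τ c 1 s] k

lemma contDiffOn_tensionComp (τ : ℝ) {c : ℝ → ℂ × ℂ} {I : Set ℝ} (hI : IsOpen I)
    (hc : ContDiffOn ℝ ∞ c I) (k : Fin 3) : ContDiffOn ℝ ∞ (tensionComp τ c k) I := by
  have hT := contDiffOn_velocity τ hI hc
  have hT' : ∀ k, ContDiffOn ℝ ∞ (deriv (velocity τ c k)) I := fun k =>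
    (hT k).deriv_of_isOpen hI (by simp)
  fin_cases k
  · exact hT' 0
  · exact (hT' 1).add ((contDiffOn_const.mul (hT 0)).mul (hT 2))
  · exact (hT' 2).sub ((contDiffOn_const.mul (hT 0)).mul (hT 1))

/-- The squared norm of the tension field in terms of the velocity `V` and its derivative `D`. -/
noncomputable def bienergyDensity (τ : ℝ) (V D : Fin 3 → ℝ) : ℝ :=
  D 0 ^ 2 + (D 1 + 2 * (τ + τ⁻¹) * V 0 * V 2) ^ 2 + (D 2 - 2 * (τ + τ⁻¹) * V 0 * V 1) ^ 2

lemma hasDerivAt_bienergyDensity (τ : ℝ) {V D : ℝ → Fin 3 → ℝ} {V' D' : Fin 3 → ℝ} {t : ℝ}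
    (hV : ∀ k, HasDerivAt (fun t => V t k) (V' k) t)
    (hD : ∀ k, HasDerivAt (fun t => D t k) (D' k) t) :
    HasDerivAt (fun t => bienergyDensity τ (V t) (D t))
      (2 * (D t 0 * D' 0
        + (D t 1 + 2 * (τ + τ⁻¹) * V t 0 * V t 2)
          * (D' 1 + 2 * (τ + τ⁻¹) * (V' 0 * V t 2 + V t 0 * V' 2))
        + (D t 2 - 2 * (τ + τ⁻¹) * V t 0 * V t 1)
          * (D' 2 - 2 * (τ + τ⁻¹) * (V' 0 * V t 1 + V t 0 * V' 1)))) t := by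
  have h := (((hD 0).pow 2).add (((hD 1).add
    (((hV 0).const_mul (2 * (τ + τ⁻¹))).mul (hV 2))).pow 2)).add (((hD 2).sub
    (((hV 0).const_mul (2 * (τ + τ⁻¹))).mul (hV 1))).pow 2)
  refine h.congr_deriv ?_
  simp
  ring

section Variation

variable {τ σ : ℝ} {A : ℂ × ℂ → ℂ × ℂ} {cf sf : ℝ → ℝ} {α : Fin 3 → ℝ}
  {R : ℝ → Fin 3 → Fin 3 → ℝ} {ρ : Fin 3 → Fin 3 → ℝ} {γ : ℝ → ℂ × ℂ} {I : Set ℝ} {φ : ℝ → ℝ}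

/-- Along the varied curve the frame components are explicit functions of t, φ and the velocity of
γ, so the varying base point disappears and the t-derivative can be taken on a scalar integrand. -/
lemma FrameFlow.bienergy_eq (hA : FrameFlow τ A σ cf sf α R ρ) (hτ : τ ≠ 0) (hI : IsOpen I)
    (hγ : ContDiffOn ℝ ∞ γ I) (hSL : ∀ s ∈ I, γ s ∈ SL2) (hφ : ContDiff ℝ ∞ φ) {a b : ℝ}
    (hab : a ≤ b) (habI : Icc a b ⊆ I) (t : ℝ) :
    bienergy τ (fun s => cf (t * φ s) • γ s + sf (t * φ s) • A (γ s)) a b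
      = (1 / 2) * ∫ s in a..b, bienergyDensity τ
        (fun k => ∑ j, R (t * φ s) k j * velocity τ γ j s + t * deriv φ s * α k)
        (fun k => ∑ j, (deriv (fun θ => R θ k j) (t * φ s) * (t * deriv φ s) * velocity τ γ j s
          + R (t * φ s) k j * deriv (velocity τ γ j) s) + t * deriv (deriv φ) s * α k) := by
  set c : ℝ → ℂ × ℂ := fun s => cf (t * φ s) • γ s + sf (t * φ s) • A (γ s) with hc
  have hcSL : ∀ s ∈ I, c s ∈ SL2 := fun s hs =>
    sl2_of_sq_sub_sq hA.inner_self hA.inner_apply (hA.sq_sub_sq _) (hSL s hs)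
  have hφ1 : ContDiff ℝ ∞ (deriv φ) := by simpa using hφ.iterate_deriv 1
  have hd0 : ∀ s, HasDerivAt φ (deriv φ s) s := fun s =>
    (hφ.differentiable (by simp) s).hasDerivAt
  have hd1 : ∀ s, HasDerivAt (deriv φ) (deriv (deriv φ) s) s := fun s =>
    (hφ1.differentiable (by simp) s).hasDerivAt
  have hvel : ∀ k, ∀ s ∈ I, velocity τ c k s
      = ∑ j, R (t * φ s) k j * velocity τ γ j s + t * deriv φ s * α k := by
    intro k s hs
    refine velocity_eq_of_deriv_eq (a := fun k =>
      ∑ j, R (t * φ s) k j * velocity τ γ j s + t * deriv φ s * α k) hτ (hcSL s hs) ?_ k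
    have hd : HasDerivAt γ (deriv γ s) s :=
      ((hγ.differentiableOn (by simp)).differentiableAt (hI.mem_nhds hs)).hasDerivAt
    rw [deriv_eq_sum_velocity hτ hI hγ hSL hs] at hd
    exact (hA.hasDerivAt_flow hd ((hd0 s).const_mul t)).deriv
  have hvel' : ∀ k, ∀ s ∈ I, deriv (velocity τ c k) s
      = ∑ j, (deriv (fun θ => R θ k j) (t * φ s) * (t * deriv φ s) * velocity τ γ j s
          + R (t * φ s) k j * deriv (velocity τ γ j) s) + t * deriv (deriv φ) s * α k := by
    intro k s hs
    have heq : velocity τ c k =ᶠ[nhds s] fun s =>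
        ∑ j, R (t * φ s) k j * velocity τ γ j s + t * deriv φ s * α k := by
      filter_upwards [hI.mem_nhds hs] with r hr using hvel k r hr
    rw [heq.deriv_eq]
    have hR : ∀ j, HasDerivAt (fun r => R (t * φ r) k j)
        (deriv (fun θ => R θ k j) (t * φ s) * (t * deriv φ s)) s := fun j =>
      HasDerivAt.comp s (((hA.contDiff_R k j).differentiable (by simp) _).hasDerivAt)
        ((hd0 s).const_mul t)
    have hT : ∀ j, HasDerivAt (velocity τ γ j) (deriv (velocity τ γ j) s) s := fun j =>
      (((contDiffOn_velocity τ hI hγ j).differentiableOn (by simp)).differentiableAt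
        (hI.mem_nhds hs)).hasDerivAt
    exact ((HasDerivAt.fun_sum (u := Finset.univ) fun j _ => (hR j).mul (hT j)).add
      (((hd1 s).const_mul t).mul_const (α k))).deriv
  unfold bienergy
  congr 1
  apply intervalIntegral.integral_congr
  intro s hs
  rw [uIcc_of_le hab] at hs
  simp only [metric_tension hτ c (hcSL s (habI hs)), hvel _ s (habI hs), hvel' _ s (habI hs),
    bienergyDensity]

lemma FrameFlow.integral_firstVariation_eq_zero (hA : FrameFlow τ A σ cf sf α R ρ) (hτ : τ ≠ 0)
    (hI : IsOpen I) (hγ : ContDiffOn ℝ ∞ γ I) (hSL : ∀ s ∈ I, γ s ∈ SL2)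
    (hbi : IsBiharmonic τ γ I) (hφ : ContDiff ℝ ∞ φ) {a b : ℝ}
    (hab : a < b) (habI : Icc a b ⊆ I) (hsupp : tsupport φ ⊆ Ioo a b)
    {V' D' : Fin 3 → ℝ → ℝ}
    (hV' : ∀ k s, V' k s = ∑ j, ρ k j * φ s * velocity τ γ j s + deriv φ s * α k)
    (hD' : ∀ k s, D' k s = ∑ j, (ρ k j * deriv φ s * velocity τ γ j s
      + ρ k j * φ s * deriv (velocity τ γ j) s) + deriv (deriv φ) s * α k) :
    ∫ s in a..b, (tensionComp τ γ 0 s * D' 0 s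
        + tensionComp τ γ 1 s * (D' 1 s + 2 * (τ + τ⁻¹)
          * (V' 0 s * velocity τ γ 2 s + velocity τ γ 0 s * V' 2 s))
        + tensionComp τ γ 2 s * (D' 2 s - 2 * (τ + τ⁻¹)
          * (V' 0 s * velocity τ γ 1 s + velocity τ γ 0 s * V' 1 s))) = 0 := by
  have hφ1 : ContDiff ℝ ∞ (deriv φ) := by simpa using hφ.iterate_deriv 1
  have hφ2 : ContDiff ℝ ∞ (deriv (deriv φ)) := by simpa using hφ1.iterate_deriv 1
  set U : Set (ℝ × ℝ) := Ioo (-1) 1 ×ˢ I with hU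
  have hsnd : MapsTo (Prod.snd : ℝ × ℝ → ℝ) U I := fun q hq => hq.2
  have hγ2 : ContDiffOn ℝ ∞ (fun q : ℝ × ℝ => γ q.2) U := hγ.comp contDiffOn_snd hsnd
  have hθ : ContDiff ℝ ∞ (fun q : ℝ × ℝ => q.1 * φ q.2) := contDiff_fst.mul (hφ.comp contDiff_snd)
  have hΓ : ContDiffOn ℝ ∞ (fun q : ℝ × ℝ =>
      cf (q.1 * φ q.2) • γ q.2 + sf (q.1 * φ q.2) • A (γ q.2)) U :=
    ((hA.contDiff_cf.comp hθ).contDiffOn.smul hγ2).add ((hA.contDiff_sf.comp hθ).contDiffOn.smul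
      ((contDiff_of_isLinearMap hA.linear).comp_contDiffOn hγ2))
  -- The flow is defined for all times, so ε = 1 is an arbitrary choice. Outside the support of φ
  -- the flow time is 0 and the curve does not move.
  have hcrit := hbi 1 a b (fun t s => cf (t * φ s) • γ s + sf (t * φ s) • A (γ s)) one_pos hab habI
    hΓ (fun t _ s hs => sl2_of_sq_sub_sq hA.inner_self hA.inner_apply (hA.sq_sub_sq _) (hSL s hs))
    (fun s _ => by simp [hA.cf_zero, hA.sf_zero])
    (fun t _ s hs => by
      have : φ s = 0 := image_eq_zero_of_notMem_tsupport
        fun h => hs.2 (Ioo_subset_Icc_self (hsupp h))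
      simp [this, hA.cf_zero, hA.sf_zero])
  simp only [hA.bienergy_eq hτ hI hγ hSL hφ hab.le habI] at hcrit
  have hT : ∀ j, ContDiffOn ℝ ∞ (fun q : ℝ × ℝ => velocity τ γ j q.2) U := fun j =>
    (contDiffOn_velocity τ hI hγ j).comp contDiffOn_snd hsnd
  have hT' : ∀ j, ContDiffOn ℝ ∞ (fun q : ℝ × ℝ => deriv (velocity τ γ j) q.2) U := fun j =>
    ((contDiffOn_velocity τ hI hγ j).deriv_of_isOpen hI (by simp)).comp contDiffOn_snd hsnd
  have hR : ∀ k j, ContDiffOn ℝ ∞ (fun q : ℝ × ℝ => R (q.1 * φ q.2) k j) U := fun k j =>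
    ((hA.contDiff_R k j).comp hθ).contDiffOn
  have hdR : ∀ k j, ContDiff ℝ ∞ (deriv (fun θ => R θ k j)) := fun k j => by
    simpa using (hA.contDiff_R k j).iterate_deriv 1
  have hR' : ∀ k j, ContDiffOn ℝ ∞
      (fun q : ℝ × ℝ => deriv (fun θ => R θ k j) (q.1 * φ q.2)) U := fun k j =>
    ((hdR k j).comp hθ).contDiffOn
  have h1 : ContDiffOn ℝ ∞ (fun q : ℝ × ℝ => q.1 * deriv φ q.2) U :=
    (contDiff_fst.mul (hφ1.comp contDiff_snd)).contDiffOn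
  have h2 : ContDiffOn ℝ ∞ (fun q : ℝ × ℝ => q.1 * deriv (deriv φ) q.2) U :=
    (contDiff_fst.mul (hφ2.comp contDiff_snd)).contDiffOn
  have hV : ∀ k, ContDiffOn ℝ ∞ (fun q : ℝ × ℝ =>
      ∑ j, R (q.1 * φ q.2) k j * velocity τ γ j q.2 + q.1 * deriv φ q.2 * α k) U := fun k =>
    (ContDiffOn.sum fun j _ => (hR k j).mul (hT j)).add (h1.mul contDiffOn_const)
  have hD : ∀ k, ContDiffOn ℝ ∞ (fun q : ℝ × ℝ =>
      ∑ j, (deriv (fun θ => R θ k j) (q.1 * φ q.2) * (q.1 * deriv φ q.2) * velocity τ γ j q.2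
          + R (q.1 * φ q.2) k j * deriv (velocity τ γ j) q.2)
        + q.1 * deriv (deriv φ) q.2 * α k) U := fun k =>
    (ContDiffOn.sum fun j _ => (((hR' k j).mul h1).mul (hT j)).add ((hR k j).mul (hT' j))).add
      (h2.mul contDiffOn_const)
  have hdens := ((hD 0).pow 2).add (((hD 1).add
    ((contDiffOn_const (c := 2 * (τ + τ⁻¹)).mul (hV 0)).mul (hV 2))).pow 2) |>.add (((hD 2).sub
    ((contDiffOn_const (c := 2 * (τ + τ⁻¹)).mul (hV 0)).mul (hV 1))).pow 2)
  have hpt : ∀ s, ∀ f : ℝ → ℝ, HasDerivAt (fun t : ℝ => t * f s) (f s) 0 := fun s f => by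
    simpa using (hasDerivAt_id (0 : ℝ)).mul_const (f s)
  have hRt : ∀ k j s, HasDerivAt (fun t => R (t * φ s) k j) (ρ k j * φ s) 0 := fun k j s => by
    have : HasDerivAt (fun θ => R θ k j) (ρ k j) (0 * φ s) := by
      rw [zero_mul]; exact hA.hasDerivAt_R k j
    exact HasDerivAt.comp (0 : ℝ) this (hpt s φ)
  have hdRt : ∀ k j s, HasDerivAt (fun t => deriv (fun θ => R θ k j) (t * φ s) * (t * deriv φ s))
      (ρ k j * deriv φ s) 0 := fun k j s => by
    have h := (((hdR k j).differentiable (by simp) (0 * φ s)).hasDerivAt.comp (0 : ℝ)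
      (hpt s φ)).mul (hpt s (deriv φ))
    refine h.congr_deriv ?_
    simp [(hA.hasDerivAt_R k j).deriv]
  have hdV : ∀ k s, HasDerivAt (fun t =>
      ∑ j, R (t * φ s) k j * velocity τ γ j s + t * deriv φ s * α k) (V' k s) 0 := fun k s => by
    rw [hV']
    exact (HasDerivAt.fun_sum fun j _ => (hRt k j s).mul_const _).add ((hpt s (deriv φ)).mul_const _)
  have hdD : ∀ k s, HasDerivAt (fun t =>
      ∑ j, (deriv (fun θ => R θ k j) (t * φ s) * (t * deriv φ s) * velocity τ γ j s
          + R (t * φ s) k j * deriv (velocity τ γ j) s)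
        + t * deriv (deriv φ) s * α k) (D' k s) 0 := fun k s => by
    rw [hD']
    exact (HasDerivAt.fun_sum fun j _ => ((hdRt k j s).mul_const _).add
      ((hRt k j s).mul_const _)).add ((hpt s (deriv (deriv φ))).mul_const _)
  have hder := (hasDerivAt_intervalIntegral_of_contDiffOn (F := fun t s => bienergyDensity τ
        (fun k => ∑ j, R (t * φ s) k j * velocity τ γ j s + t * deriv φ s * α k)
        (fun k => ∑ j, (deriv (fun θ => R θ k j) (t * φ s) * (t * deriv φ s) * velocity τ γ j s
          + R (t * φ s) k j * deriv (velocity τ γ j) s) + t * deriv (deriv φ) s * α k))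
    hI one_pos hab.le habI (hdens.of_le (by simp))
    (fun s _ => hasDerivAt_bienergyDensity τ (fun k => hdV k s) (fun k => hdD k s))).const_mul
    (1 / 2 : ℝ)
  have hzero := hder.unique hcrit
  rw [intervalIntegral.integral_const_mul, ← mul_assoc] at hzero
  norm_num at hzero
  rw [← hzero]
  apply intervalIntegral.integral_congr
  intro s _
  simp [hA.R_zero, tensionComp]

end Variation

/-! ### The Euler-Lagrange system -/

lemma exists_Icc_subset {I : Set ℝ} (hI : IsOpen I) {s : ℝ} (hs : s ∈ I) :
    ∃ a b, Icc a b ⊆ I ∧ s ∈ Ioo a b := by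
  obtain ⟨ε, hε, h⟩ := Metric.isOpen_iff.1 hI s hs
  refine ⟨s - ε / 2, s + ε / 2, fun r hr => h ?_, by constructor <;> linarith⟩
  rw [Real.ball_eq_Ioo]
  constructor <;> linarith [hr.1, hr.2]

lemma hasDerivAt_of_contDiffOn {f : ℝ → ℝ} {I : Set ℝ} (hI : IsOpen I) (hf : ContDiffOn ℝ ∞ f I)
    {s : ℝ} (hs : s ∈ I) : HasDerivAt f (deriv f s) s :=
  ((hf.differentiableOn (by simp)).differentiableAt (hI.mem_nhds hs)).hasDerivAt

lemma FrameFlow.eulerLagrange {τ σ : ℝ} {A : ℂ × ℂ → ℂ × ℂ} {cf sf : ℝ → ℝ} {α : Fin 3 → ℝ}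
    {R : ℝ → Fin 3 → Fin 3 → ℝ} {ρ : Fin 3 → Fin 3 → ℝ} {γ : ℝ → ℂ × ℂ} {I : Set ℝ}
    (hA : FrameFlow τ A σ cf sf α R ρ) (hτ : τ ≠ 0)
    (hI : IsOpen I) (hγ : ContDiffOn ℝ ∞ γ I) (hSL : ∀ s ∈ I, γ s ∈ SL2)
    (hbi : IsBiharmonic τ γ I) {T w r : Fin 3 → ℝ → ℝ} (hT : T = velocity τ γ)
    (hw : w = tensionComp τ γ) (hr : ∀ k s, r k s = ∑ j, ρ k j * T j s) {s : ℝ} (hs : s ∈ I) :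
    ∑ k, (α k * deriv (deriv (w k)) s - r k s * deriv (w k) s)
      - 2 * (τ + τ⁻¹) * (deriv (w 1) s * (α 0 * T 2 s + α 2 * T 0 s)
        + w 1 s * (α 0 * deriv (T 2) s + α 2 * deriv (T 0) s)
        - w 1 s * (r 0 s * T 2 s + T 0 s * r 2 s))
      + 2 * (τ + τ⁻¹) * (deriv (w 2) s * (α 0 * T 1 s + α 1 * T 0 s)
        + w 2 s * (α 0 * deriv (T 1) s + α 1 * deriv (T 0) s)
        - w 2 s * (r 0 s * T 1 s + T 0 s * r 1 s)) = 0 := by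
  obtain ⟨a, b, habI, hsab⟩ := exists_Icc_subset hI hs
  have hab : a < b := hsab.1.trans hsab.2
  have cT : ∀ k, ContDiffOn ℝ ∞ (T k) I := fun k => hT ▸ contDiffOn_velocity τ hI hγ k
  have cw : ∀ k, ContDiffOn ℝ ∞ (w k) I := fun k => hw ▸ contDiffOn_tensionComp τ hI hγ k
  have cd : ∀ {f : ℝ → ℝ}, ContDiffOn ℝ ∞ f I → ContDiffOn ℝ ∞ (deriv f) I :=
    fun hf => hf.deriv_of_isOpen hI (by simp)
  have cr : ∀ k, ContDiffOn ℝ ∞ (r k) I := fun k => by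
    have : r k = fun s => ∑ j, ρ k j * T j s := funext (hr k)
    rw [this]
    exact ContDiffOn.sum fun j _ => contDiffOn_const.mul (cT j)
  have hdr : ∀ k, ∀ s ∈ I, HasDerivAt (r k) (∑ j, ρ k j * deriv (T j) s) s := fun k s hs => by
    have : r k = fun s => ∑ j, ρ k j * T j s := funext (hr k)
    rw [this]
    exact HasDerivAt.fun_sum fun j _ => (hasDerivAt_of_contDiffOn hI (cT j) hs).const_mul _
  have cdr : ∀ k, ContDiffOn ℝ ∞ (fun s => ∑ j, ρ k j * deriv (T j) s) I := fun k =>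
    ContDiffOn.sum fun j _ => contDiffOn_const.mul (cd (cT j))
  set C := 2 * (τ + τ⁻¹) with hC
  -- The functions f, g, h collect the coefficients of φ'', φ' and φ in the first variation, where r
  -- = ρT.
  have hkey := eulerLagrange_of_integral_eq_zero hab
    (f := fun s => α 0 * w 0 s + α 1 * w 1 s + α 2 * w 2 s)
    (f' := fun s => α 0 * deriv (w 0) s + α 1 * deriv (w 1) s + α 2 * deriv (w 2) s)
    (f'' := fun s => α 0 * deriv (deriv (w 0)) s + α 1 * deriv (deriv (w 1)) s
      + α 2 * deriv (deriv (w 2)) s)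
    (g := fun s => w 0 s * r 0 s + w 1 s * (r 1 s + C * (α 0 * T 2 s + α 2 * T 0 s))
      + w 2 s * (r 2 s - C * (α 0 * T 1 s + α 1 * T 0 s)))
    (g' := fun s => deriv (w 0) s * r 0 s + w 0 s * (∑ j, ρ 0 j * deriv (T j) s)
      + (deriv (w 1) s * (r 1 s + C * (α 0 * T 2 s + α 2 * T 0 s)) + w 1 s *
        ((∑ j, ρ 1 j * deriv (T j) s) + C * (α 0 * deriv (T 2) s + α 2 * deriv (T 0) s)))
      + (deriv (w 2) s * (r 2 s - C * (α 0 * T 1 s + α 1 * T 0 s)) + w 2 s *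
        ((∑ j, ρ 2 j * deriv (T j) s) - C * (α 0 * deriv (T 1) s + α 1 * deriv (T 0) s))))
    (h := fun s => w 0 s * (∑ j, ρ 0 j * deriv (T j) s)
      + w 1 s * ((∑ j, ρ 1 j * deriv (T j) s) + C * (r 0 s * T 2 s + T 0 s * r 2 s))
      + w 2 s * ((∑ j, ρ 2 j * deriv (T j) s) - C * (r 0 s * T 1 s + T 0 s * r 1 s)))
    (fun s hs => by
      have h := fun k => hasDerivAt_of_contDiffOn hI (cw k) (habI hs)
      exact (((h 0).const_mul _).add ((h 1).const_mul _)).add ((h 2).const_mul _))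
    (fun s hs => by
      have h := fun k => hasDerivAt_of_contDiffOn hI (cd (cw k)) (habI hs)
      exact (((h 0).const_mul _).add ((h 1).const_mul _)).add ((h 2).const_mul _))
    (fun s hs => by
      have h := fun k => hasDerivAt_of_contDiffOn hI (cw k) (habI hs)
      have hT := fun k => hasDerivAt_of_contDiffOn hI (cT k) (habI hs)
      have hr := fun k => hdr k s (habI hs)
      exact (((h 0).mul (hr 0)).add ((h 1).mul ((hr 1).add
        ((((hT 2).const_mul _).add ((hT 0).const_mul _)).const_mul C)))).add
        ((h 2).mul ((hr 2).sub ((((hT 1).const_mul _).add ((hT 0).const_mul _)).const_mul C))))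
    (by
      have h := fun k => (cd (cd (cw k))).continuousOn.mono habI
      exact ((continuousOn_const.mul (h 0)).add (continuousOn_const.mul (h 1))).add
        (continuousOn_const.mul (h 2)))
    (by
      have h := fun k => (cw k).continuousOn.mono habI
      have h' := fun k => (cd (cw k)).continuousOn.mono habI
      have hT := fun k => (cT k).continuousOn.mono habI
      have hT' := fun k => (cd (cT k)).continuousOn.mono habI
      have hr := fun k => (cr k).continuousOn.mono habI
      have hr' := fun k => (cdr k).continuousOn.mono habI
      have e : ∀ i j (x y : ℝ), ContinuousOn (fun s => C * (x * T i s + y * T j s)) (Icc a b) :=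
        fun i j x y => continuousOn_const.mul ((continuousOn_const.mul (hT i)).add
          (continuousOn_const.mul (hT j)))
      have e' : ∀ i j (x y : ℝ),
          ContinuousOn (fun s => C * (x * deriv (T i) s + y * deriv (T j) s)) (Icc a b) :=
        fun i j x y => continuousOn_const.mul ((continuousOn_const.mul (hT' i)).add
          (continuousOn_const.mul (hT' j)))
      exact ((((h' 0).mul (hr 0)).add ((h 0).mul (hr' 0))).add
        (((h' 1).mul ((hr 1).add (e _ _ _ _))).add ((h 1).mul ((hr' 1).add (e' _ _ _ _))))).add
        (((h' 2).mul ((hr 2).sub (e _ _ _ _))).add ((h 2).mul ((hr' 2).sub (e' _ _ _ _)))))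
    (by
      have h := fun k => (cw k).continuousOn.mono habI
      have hT := fun k => (cT k).continuousOn.mono habI
      have hr := fun k => (cr k).continuousOn.mono habI
      have hr' := fun k => (cdr k).continuousOn.mono habI
      have e : ∀ i, ContinuousOn (fun s => C * (r 0 s * T i s + T 0 s * r i s)) (Icc a b) :=
        fun i => continuousOn_const.mul (((hr 0).mul (hT i)).add ((hT 0).mul (hr i)))
      exact (((h 0).mul (hr' 0)).add ((h 1).mul ((hr' 1).add (e 2)))).add
        ((h 2).mul ((hr' 2).sub (e 1))))
    (fun φ hφ hsupp => by
      have := hA.integral_firstVariation_eq_zero hτ hI hγ hSL hbi hφ hab habI hsupp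
        (V' := fun k s => ∑ j, ρ k j * φ s * velocity τ γ j s + deriv φ s * α k)
        (D' := fun k s => ∑ j, (ρ k j * deriv φ s * velocity τ γ j s
          + ρ k j * φ s * deriv (velocity τ γ j) s) + deriv (deriv φ) s * α k)
        (fun _ _ => rfl) (fun _ _ => rfl)
      rw [← this]
      apply intervalIntegral.integral_congr
      intro s _
      simp only [hr, ← hT, ← hw, ← hC, Fin.sum_univ_three]
      ring)
    hsab
  simp only [Fin.sum_univ_three] at hkey ⊢
  -- The terms w_k r_k' of g' and of h cancel.
  linear_combination hkey

/-- The tangential part of the Euler-Lagrange system: the norm of the tension field has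
derivative zero. -/
lemma tension_inner_deriv_eq_zero (τ k u x y w0 w1 w2 p0 p1 p2 q0 q1 q2 x' y' C : ℝ) (hC : C = 2 * (τ + k)) (hk : τ * k = 1)
  (hx : x' = w1 - C * u * y) (hy : y' = w2 + C * u * x)
  (C2 : u * w0 + x * w1 + y * w2 = 0)
  (C3 : w0 * w0 + x' * w1 + y' * w2 + u * p0 + x * p1 + y * p2 = 0)
  (C4 : 2 * w0 * p0 + (p1 - C * (w0 * y + u * y')) * w1 + 2 * x' * p1
    + (p2 + C * (w0 * x + u * x')) * w2 + 2 * y' * p2 + w0 * p0 + u * q0 + x * q1 + y * q2 = 0)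
  (E0 : q0 + 2 * τ * (x' * w2 + x * p2 - y' * w1 - y * p1) = 0)
  (E1 : q1 + 2 * τ * y * p0 + 2 * k * u * p2 - C * (w1 * (2 * τ * y * y + 2 * k * u * u))
     + C * (p2 * u + w2 * w0 + 2 * τ * w2 * y * x) = 0)
  (E2 : q2 - 2 * τ * x * p0 - 2 * k * u * p1 - C * (p1 * u + w1 * w0 - w1 * (2 * τ * x * y))
     - C * w2 * (2 * τ * x * x + 2 * k * u * u) = 0) : w0 * p0 + w1 * p1 + w2 * p2 = 0 := by
  -- Invariantly, two derivatives of ⟨T, w⟩ = 0 give 3⟨w, ∇w⟩ + ⟨T, ∇²w⟩ = 0, and the combination u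
  -- E0 + x E1 + y E2 says ⟨T, ∇²w⟩ = 0.
  grind

/-- The part of the Euler-Lagrange system normal to the velocity and horizontal, in terms of
`u`, `m = x w₂ - y w₁` and the squared norm `K` of the tension field. -/
lemma normal_equation (τ k u x y w0 w1 w2 p0 p1 p2 q1 q2 x' y' m m1 m2 K C : ℝ) (hC : C = 2 * (τ + k)) (hk : τ * k = 1)
  (hx : x' = w1 - C * u * y) (hy : y' = w2 + C * u * x)
  (C1 : u ^ 2 + x ^ 2 + y ^ 2 = 1)
  (C2 : u * w0 + x * w1 + y * w2 = 0)
  (C3 : w0 * w0 + x' * w1 + y' * w2 + u * p0 + x * p1 + y * p2 = 0)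
  (E1 : q1 + 2 * τ * y * p0 + 2 * k * u * p2 - C * (w1 * (2 * τ * y * y + 2 * k * u * u))
     + C * (p2 * u + w2 * w0 + 2 * τ * w2 * y * x) = 0)
  (E2 : q2 - 2 * τ * x * p0 - 2 * k * u * p1 - C * (p1 * u + w1 * w0 - w1 * (2 * τ * x * y))
     - C * w2 * (2 * τ * x * x + 2 * k * u * u) = 0)
  (hm : m = x * w2 - y * w1) (hm1 : m1 = x' * w2 + x * p2 - y' * w1 - y * p1)
  (hm2 : m2 = (p1 - C * (w0 * y + u * y')) * w2 + 2 * x' * p2 + x * q2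
    - (p2 + C * (w0 * x + u * x')) * w1 - 2 * y' * p1 - y * q1)
  (hK : K = w0 ^ 2 + w1 ^ 2 + w2 ^ 2) :
   (1 - u^2) * (-m2 + 2 * τ * (K * u + p0)) + 4 * (1 + τ ^ 2) * (1 - u^2) ^ 2 * m - u * w0 * m1 + m * u * p0 + K * m = 0 := by
  -- The horizontal parts of w and p are resolved along (x, y) and (-y, x). Their wedge j is then
  -- known only after multiplication by r = 1 - u², which is the source of the powers of 1 - u² in
  -- the conclusion.
  obtain ⟨r, hr⟩ : ∃ r, r = x ^ 2 + y ^ 2 := ⟨_, rfl⟩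
  obtain ⟨l, hl⟩ : ∃ l, l = x * p1 + y * p2 := ⟨_, rfl⟩
  obtain ⟨n, hn⟩ : ∃ n, n = x * p2 - y * p1 := ⟨_, rfl⟩
  obtain ⟨j, hj⟩ : ∃ j, j = w1 * p2 - w2 * p1 := ⟨_, rfl⟩
  have hur : u ^ 2 = 1 - r := by linear_combination C1 + hr
  have S3 : l = -(K + C * u * m + u * p0) := by rw [hl, hK, hm]; subst x' y'; linear_combination C3
  have S4 : m1 = n + C * u ^ 2 * w0 := by
    rw [hm1, hn]; subst x' y'; linear_combination - C * u * C2
  have S5 : x * q2 - y * q1 = 2 * τ * r * p0 + (2 * k + C) * u * l - C * u * w0 ^ 2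
      + 2 * τ * C * r * m + 2 * k * C * u ^ 2 * m := by
    rw [hr, hl, hm]; linear_combination x * E2 - y * E1 + C * w0 * C2
  have S6 : r * j = - u * w0 * n - m * l := by
    rw [hr, hj, hn, hm, hl]; linear_combination (x * p2 - y * p1) * C2
  have S7 : r * K = w0 ^ 2 + m ^ 2 := by
    rw [hK, hm, hr]; linear_combination w0 ^ 2 * C1 + (x * w1 + y * w2 - u * w0) * C2
  have S8 : m2 = j + C * u * w0 ^ 2 - C * u * (K - w0 ^ 2) - C ^ 2 * u ^ 2 * m - 2 * C * u * l
      + (x * q2 - y * q1) := by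
    rw [hm2, hj, hK, hm, hl]; subst x' y'; linear_combination -C * w0 * C2
  clear hm hm1 hm2 hK hx hy C1 C2 C3 E1 E2 hr hl hn hj
  rw [S5] at S8
  subst l m1 m2
  grind

/-! ### The vertical component of the velocity is constant -/

lemma eq_zero_of_hasDerivAt_of_const {f : ℝ → ℝ} {I : Set ℝ} (hI : IsOpen I) {c f' s : ℝ}
    (h : ∀ r ∈ I, f r = c) (hs : s ∈ I) (hf : HasDerivAt f f' s) : f' = 0 := by
  refine hf.unique ((hasDerivAt_const s c).congr_of_eventuallyEq ?_)
  filter_upwards [hI.mem_nhds hs] with r hr using h r hr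

/-- Suppose u' ≠ 0 somewhere. The sets U (where u' ≠ 0) and V (where also m ≠ 0) are open, so every
relation found on them may be differentiated again. With D = A + Ku, elimination shows first that V
is empty, then that D vanishes on U. -/
lemma deriv_eq_zero_of_system {I : Set ℝ} (hI : IsOpen I) {u m : ℝ → ℝ} {τ K A : ℝ} (hτ : τ ≠ 0)
    (hK : K ≠ 0) (hu : ContDiffOn ℝ ∞ u I) (hm : ContDiffOn ℝ ∞ m I)
    (h1 : ∀ s ∈ I, deriv (deriv u) s = A - 2 * τ * m s)
    (h2 : ∀ s ∈ I, deriv u s ^ 2 + m s ^ 2 - K * (1 - u s ^ 2) = 0)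
    (h3 : ∀ s ∈ I, (1 - u s ^ 2) * (-deriv (deriv m) s + 2 * τ * (K * u s + deriv (deriv u) s))
      + 4 * (1 + τ ^ 2) * (1 - u s ^ 2) ^ 2 * m s - u s * deriv u s * deriv m s
      + m s * u s * deriv (deriv u) s + K * m s = 0) {s : ℝ} (hs : s ∈ I) : deriv u s = 0 := by
  by_contra hne
  have cd : ∀ {f : ℝ → ℝ}, ContDiffOn ℝ ∞ f I → ContDiffOn ℝ ∞ (deriv f) I :=
    fun hf => hf.deriv_of_isOpen hI (by simp)
  have du : ∀ s ∈ I, HasDerivAt u (deriv u s) s := fun s hs => hasDerivAt_of_contDiffOn hI hu hs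
  have du' : ∀ s ∈ I, HasDerivAt (deriv u) (A - 2 * τ * m s) s := fun s hs =>
    h1 s hs ▸ hasDerivAt_of_contDiffOn hI (cd hu) hs
  have dm : ∀ s ∈ I, HasDerivAt m (deriv m s) s := fun s hs => hasDerivAt_of_contDiffOn hI hm hs
  have dm' : ∀ s ∈ I, HasDerivAt (deriv m) (deriv (deriv m) s) s := fun s hs =>
    hasDerivAt_of_contDiffOn hI (cd hm) hs
  set U : Set ℝ := I ∩ deriv u ⁻¹' {0}ᶜ with hU
  have hUo : IsOpen U := (cd hu).continuousOn.isOpen_inter_preimage hI isOpen_compl_singleton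
  have hUI : U ⊆ I := inter_subset_left
  have e1 : ∀ s ∈ U, m s * deriv m s - deriv u s * (2 * τ * m s - (A + K * u s)) = 0 := by
    intro s hs
    have hsI := hUI hs
    have := eq_zero_of_hasDerivAt_of_const hI h2 hsI
      ((((du' s hsI).pow 2).add ((dm s hsI).pow 2)).sub
        ((((du s hsI).pow 2).const_sub 1).const_mul K))
    simp at this
    linear_combination this / 2
  have e2 : ∀ s ∈ U, deriv m s ^ 2 + m s * deriv (deriv m) s
      = (A - 2 * τ * m s) * (2 * τ * m s - (A + K * u s))
        + deriv u s * (2 * τ * deriv m s - K * deriv u s) := by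
    intro s hs
    have hsI := hUI hs
    have := eq_zero_of_hasDerivAt_of_const hUo e1 hs
      (((dm s hsI).mul (dm' s hsI)).sub ((du' s hsI).mul (((dm s hsI).const_mul (2 * τ)).sub
        (((du s hsI).const_mul K).const_add A))))
    linear_combination this
  set V : Set ℝ := U ∩ m ⁻¹' {0}ᶜ with hV
  have hVo : IsOpen V := (hm.continuousOn.mono hUI).isOpen_inter_preimage hUo
    isOpen_compl_singleton
  have hVempty : ¬ V.Nonempty := by
    rintro ⟨s, hs⟩
    have hVU : V ⊆ U := inter_subset_left
    -- After multiplying `h3` by m³, `e1` and `e2` remove m' and m'', and `h2` removes u'². The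
    -- factor (1 - u²)² splits off; it is nonzero, since 1 - u² = 0 would give u'² + m² = 0.
    have e3 : ∀ s ∈ V, K * (K * m s ^ 2 - 2 * τ * (A + K * u s) * m s + (A + K * u s) ^ 2)
        + 4 * (1 + τ ^ 2) * m s ^ 4 = 0 := by
      intro s hs
      have hsI := hUI (hVU hs)
      have f1 := e1 s (hVU hs)
      have f2 := e2 s (hVU hs)
      have f3 := h2 s hsI
      have f4 := h3 s hsI
      have hm0 : m s ≠ 0 := hs.2
      have hu0 : deriv u s ≠ 0 := (hVU hs).2
      have hR : 1 - u s ^ 2 ≠ 0 := by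
        intro h
        rw [h] at f3
        have : deriv u s ^ 2 > 0 := by positivity
        nlinarith [sq_nonneg (m s)]
      rw [h1 s hsI] at f4
      have : (1 - u s ^ 2) ^ 2 * (K * (K * m s ^ 2 - 2 * τ * (A + K * u s) * m s
          + (A + K * u s) ^ 2) + 4 * (1 + τ ^ 2) * m s ^ 4) = 0 := by
        linear_combination m s ^ 3 * f4 + (1 - u s ^ 2) * m s ^ 2 * f2
          + ((1 - u s ^ 2) * (2 * τ * m s * deriv u s - m s * deriv m s
            - deriv u s * (2 * τ * m s - (A + K * u s))) + u s * deriv u s * m s ^ 2) * f1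
          + ((1 - u s ^ 2) * (2 * τ * m s * (2 * τ * m s - (A + K * u s)) - K * m s ^ 2
            - (2 * τ * m s - (A + K * u s)) ^ 2)
            + u s * m s ^ 2 * (2 * τ * m s - (A + K * u s))) * f3
      simpa [hR] using this
    -- Differentiate `e3`, multiply by m to replace m m' through `e1`, and subtract 2τu' times `e3`:
    -- everything but 8(1 + τ²)m³u'(3τm - 2D) cancels.
    have e4 : ∀ s ∈ V, 2 * (A + K * u s) - 3 * τ * m s = 0 := by
      intro s hs
      have hsI := hUI (hVU hs)
      have f1 := e1 s (hVU hs)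
      have f2 := e3 s hs
      have f3 := eq_zero_of_hasDerivAt_of_const hVo e3 hs
        (((((((dm s hsI).pow 2).const_mul K).sub (((((du s hsI).const_mul K).const_add A).const_mul
          (2 * τ)).mul (dm s hsI))).add ((((du s hsI).const_mul K).const_add A).pow 2)).const_mul
          K).add (((dm s hsI).pow 4).const_mul (4 * (1 + τ ^ 2))))
      have hm0 : m s ≠ 0 := hs.2
      have hu0 : deriv u s ≠ 0 := (hVU hs).2
      simp at f3
      have : (1 + τ ^ 2) * m s ^ 3 * deriv u s * (2 * (A + K * u s) - 3 * τ * m s) = 0 := by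
        linear_combination -(m s * f3 - 2 * τ * deriv u s * f2
          - (K * (2 * K * m s - 2 * τ * (A + K * u s)) + 16 * (1 + τ ^ 2) * m s ^ 3) * f1) / 8
      have ht : 1 + τ ^ 2 ≠ 0 := by positivity
      simpa [hm0, hu0, ht] using this
    have hsI := hUI (hVU hs)
    have hm0 : m s ≠ 0 := hs.2
    have hu0 : deriv u s ≠ 0 := (hVU hs).2
    have f1 := e1 s (hVU hs)
    have f2 := e3 s hs
    have f3 := e4 s hs
    have f4 := eq_zero_of_hasDerivAt_of_const hVo e4 hs
      (((((du s hsI).const_mul K).const_add A).const_mul 2).sub ((dm s hsI).const_mul (3 * τ)))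
    -- One more derivative fixes K = 3τ²/4. With this K and D = 3τm/2 the quadratic part of `e3`
    -- vanishes, leaving m⁴ = 0.
    have f5 : m s * deriv u s * (4 * K - 3 * τ ^ 2) = 0 := by
      linear_combination 2 * m s * f4 + 6 * τ * f1 - 3 * τ * deriv u s * f3
    have f6 : 4 * K - 3 * τ ^ 2 = 0 := by simpa [hm0, hu0] using f5
    have f7 : (1 + τ ^ 2) * m s ^ 4 = 0 := by
      have hD : A + K * u s = 3 * τ * m s / 2 := by linarith
      rw [hD] at f2
      linear_combination f2 / 4 - K * m s ^ 2 * f6 / 16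
    have ht : 1 + τ ^ 2 ≠ 0 := by positivity
    simp [hm0, ht] at f7
  have hm0 : ∀ s ∈ U, m s = 0 := fun s hs => by
    by_contra h
    exact hVempty ⟨s, hs, h⟩
  have hD : ∀ s ∈ U, A + K * u s = 0 := fun s hs => by
    have f1 := e1 s hs
    have hu0 : deriv u s ≠ 0 := hs.2
    rw [hm0 s hs] at f1
    have : deriv u s * (A + K * u s) = 0 := by linear_combination f1
    simpa [hu0] using this
  have hsU : s ∈ U := ⟨hs, hne⟩
  have := eq_zero_of_hasDerivAt_of_const hUo hD hsU (((du s hs).const_mul K).const_add A)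
  simp [hK, hne] at this

lemma velocity_sq_sum {τ : ℝ} (hτ : τ ≠ 0) {c : ℝ → ℂ × ℂ} {I : Set ℝ} (hI : IsOpen I)
    (hc : ContDiffOn ℝ ∞ c I) (hSL : ∀ s ∈ I, c s ∈ SL2) {s : ℝ} (hs : s ∈ I) :
    metric τ (c s) (deriv c s) (deriv c s)
      = velocity τ c 0 s ^ 2 + velocity τ c 1 s ^ 2 + velocity τ c 2 s ^ 2 := by
  rw [deriv_eq_sum_velocity hτ hI hc hSL hs, Fin.sum_univ_three, metric_comb hτ (hSL s hs)]

lemma exists_const_of_hasDerivAt_zero {I : Set ℝ} (hI : IsOpen I) (hIc : I.OrdConnected)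
    {f : ℝ → ℝ} (hf : ∀ s ∈ I, HasDerivAt f 0 s) : ∃ a, ∀ s ∈ I, f s = a :=
  hI.exists_is_const_of_deriv_eq_zero hIc.isPreconnected
    (fun s hs => (hf s hs).differentiableAt.differentiableWithinAt) (fun s hs => (hf s hs).deriv)

lemma deriv_velocity_zero_eq_zero {τ : ℝ} (hτ : τ ≠ 0) {I : Set ℝ} (hI : IsOpen I)
    (hIc : I.OrdConnected) {γ : ℝ → ℂ × ℂ} (hγ : ContDiffOn ℝ ∞ γ I) (hSL : ∀ s ∈ I, γ s ∈ SL2)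
    (harc : ∀ s ∈ I, metric τ (γ s) (deriv γ s) (deriv γ s) = 1)
    (hbi : IsProperBiharmonic τ γ I) {s : ℝ} (hs : s ∈ I) : deriv (velocity τ γ 0) s = 0 := by
  have hk : τ * τ⁻¹ = 1 := mul_inv_cancel₀ hτ
  have cT := contDiffOn_velocity τ hI hγ
  have cw := contDiffOn_tensionComp τ hI hγ
  have cd : ∀ {f : ℝ → ℝ}, ContDiffOn ℝ ∞ f I → ContDiffOn ℝ ∞ (deriv f) I :=
    fun hf => hf.deriv_of_isOpen hI (by simp)
  have E0 := fun (s : ℝ) (hs : s ∈ I) => (frameFlow_X₁ hτ).eulerLagrange hτ hI hγ hSL hbi.1 rfl rfl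
    (fun _ _ => rfl) hs
  have E1 := fun (s : ℝ) (hs : s ∈ I) => (frameFlow_X₂ hτ).eulerLagrange hτ hI hγ hSL hbi.1 rfl rfl
    (fun _ _ => rfl) hs
  have E2 := fun (s : ℝ) (hs : s ∈ I) => (frameFlow_X₃ hτ).eulerLagrange hτ hI hγ hSL hbi.1 rfl rfl
    (fun _ _ => rfl) hs
  simp [Fin.sum_univ_three] at E0 E1 E2
  have dT := fun k (s : ℝ) (hs : s ∈ I) => hasDerivAt_of_contDiffOn hI (cT k) hs
  have dw := fun k (s : ℝ) (hs : s ∈ I) => hasDerivAt_of_contDiffOn hI (cw k) hs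
  have dp := fun k (s : ℝ) (hs : s ∈ I) => hasDerivAt_of_contDiffOn hI (cd (cw k)) hs
  have hw0 : ∀ s, tensionComp τ γ 0 s = deriv (velocity τ γ 0) s := fun s => rfl
  have hw1 : ∀ s, tensionComp τ γ 1 s = deriv (velocity τ γ 1) s
    + 2 * (τ + τ⁻¹) * velocity τ γ 0 s * velocity τ γ 2 s := fun s => rfl
  have hw2 : ∀ s, tensionComp τ γ 2 s = deriv (velocity τ γ 2) s
    - 2 * (τ + τ⁻¹) * velocity τ γ 0 s * velocity τ γ 1 s := fun s => rfl
  have C1 : ∀ s ∈ I, velocity τ γ 0 s ^ 2 + velocity τ γ 1 s ^ 2 + velocity τ γ 2 s ^ 2 = 1 :=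
    fun s hs => by rw [← velocity_sq_sum hτ hI hγ hSL hs, harc s hs]
  have hgeo : ∃ s ∈ I, tension τ γ s ≠ 0 := by
    have := hbi.2
    unfold IsGeodesic at this
    push Not at this
    exact this
  have hten : ∀ s ∈ I, tension τ γ s = tensionComp τ γ 0 s • frame τ 0 (γ s)
      + tensionComp τ γ 1 s • frame τ 1 (γ s) + tensionComp τ γ 2 s • frame τ 2 (γ s) :=
    fun s hs => tension_eq hτ γ (hSL s hs)
  generalize hu : velocity τ γ 0 = u at *
  generalize hx : velocity τ γ 1 = x at *
  generalize hy : velocity τ γ 2 = y at *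
  generalize hW0 : tensionComp τ γ 0 = w0 at *
  generalize hW1 : tensionComp τ γ 1 = w1 at *
  generalize hW2 : tensionComp τ γ 2 = w2 at *
  obtain ⟨C, hC⟩ : ∃ C, C = 2 * (τ + τ⁻¹) := ⟨_, rfl⟩
  simp only [← hC] at hw1 hw2
  have du : ∀ s ∈ I, HasDerivAt u (w0 s) s := fun s hs => by
    rw [hw0, ← hu]; exact dT 0 s hs
  have dx : ∀ s ∈ I, HasDerivAt x (w1 s - C * u s * y s) s := fun s hs => by
    have h := dT 1 s hs
    rw [hx] at h
    refine h.congr_deriv ?_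
    rw [hw1]; ring
  have dy : ∀ s ∈ I, HasDerivAt y (w2 s + C * u s * x s) s := fun s hs => by
    have h := dT 2 s hs
    rw [hy] at h
    refine h.congr_deriv ?_
    rw [hw2]; ring
  have dw0 := dw 0
  have dw1 := dw 1
  have dw2 := dw 2
  have dp0 := dp 0
  have dp1 := dp 1
  have dp2 := dp 2
  rw [hW0] at dw0 dp0
  rw [hW1] at dw1 dp1
  rw [hW2] at dw2 dp2
  -- `C2`, `C3` and `C4` are the successive derivatives of |T|² = 1. The quadratic terms of the
  -- tension drop out of `C2`.
  have C2 : ∀ s ∈ I, u s * w0 s + x s * w1 s + y s * w2 s = 0 := fun s hs => by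
    have := eq_zero_of_hasDerivAt_of_const hI C1 hs
      ((((du s hs).pow 2).add ((dx s hs).pow 2)).add ((dy s hs).pow 2))
    simp at this
    linear_combination this / 2
  have C3 : ∀ s ∈ I, w0 s * w0 s + (w1 s - C * u s * y s) * w1 s + (w2 s + C * u s * x s) * w2 s
      + u s * deriv w0 s + x s * deriv w1 s + y s * deriv w2 s = 0 := fun s hs => by
    have := eq_zero_of_hasDerivAt_of_const hI C2 hs
      ((((du s hs).mul (dw0 s hs)).add ((dx s hs).mul (dw1 s hs))).add ((dy s hs).mul (dw2 s hs)))
    linear_combination this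
  have C4 : ∀ s ∈ I, 2 * w0 s * deriv w0 s
      + (deriv w1 s - C * (w0 s * y s + u s * (w2 s + C * u s * x s))) * w1 s
      + 2 * (w1 s - C * u s * y s) * deriv w1 s
      + (deriv w2 s + C * (w0 s * x s + u s * (w1 s - C * u s * y s))) * w2 s
      + 2 * (w2 s + C * u s * x s) * deriv w2 s + w0 s * deriv w0 s + u s * deriv (deriv w0) s
      + x s * deriv (deriv w1) s + y s * deriv (deriv w2) s = 0 := fun s hs => by
    have h1 := (dw1 s hs).fun_sub (((du s hs).const_mul C).fun_mul (dy s hs))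
    have h2 := (dw2 s hs).fun_add (((du s hs).const_mul C).fun_mul (dx s hs))
    have := eq_zero_of_hasDerivAt_of_const hI C3 hs
      (((((((dw0 s hs).fun_mul (dw0 s hs)).fun_add (h1.fun_mul (dw1 s hs))).fun_add
        (h2.fun_mul (dw2 s hs))).fun_add ((du s hs).fun_mul (dp0 s hs))).fun_add
        ((dx s hs).fun_mul (dp1 s hs))).fun_add ((dy s hs).fun_mul (dp2 s hs)))
    linear_combination this
  have dux : ∀ s ∈ I, deriv x s = w1 s - C * u s * y s := fun s hs => (dx s hs).deriv
  have duy : ∀ s ∈ I, deriv y s = w2 s + C * u s * x s := fun s hs => (dy s hs).deriv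
  have E0' : ∀ s ∈ I, deriv (deriv w0) s + 2 * τ * ((w1 s - C * u s * y s) * w2 s
      + x s * deriv w2 s - (w2 s + C * u s * x s) * w1 s - y s * deriv w1 s) = 0 := by
    intro s hs
    have h := E0 s hs
    rw [dux s hs, duy s hs] at h
    have h2 := C2 s hs
    -- The factor τ is present because X₁ = -τE₀.
    have : τ * (deriv (deriv w0) s + 2 * τ * ((w1 s - C * u s * y s) * w2 s
      + x s * deriv w2 s - (w2 s + C * u s * x s) * w1 s - y s * deriv w1 s)) = 0 := by
      generalize τ⁻¹ = k at *
      clear E0 E1 E2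
      subst hC
      grind
    simpa [hτ] using this
  have E1' : ∀ s ∈ I, deriv (deriv w1) s + 2 * τ * y s * deriv w0 s + 2 * τ⁻¹ * u s * deriv w2 s
      - C * (w1 s * (2 * τ * y s * y s + 2 * τ⁻¹ * u s * u s))
      + C * (deriv w2 s * u s + w2 s * w0 s + 2 * τ * w2 s * y s * x s) = 0 := fun s hs => by
    rw [hC, hw0]
    linear_combination E1 s hs
  have E2' : ∀ s ∈ I, deriv (deriv w2) s - 2 * τ * x s * deriv w0 s - 2 * τ⁻¹ * u s * deriv w1 s
      - C * (deriv w1 s * u s + w1 s * w0 s - w1 s * (2 * τ * x s * y s))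
      - C * w2 s * (2 * τ * x s * x s + 2 * τ⁻¹ * u s * u s) = 0 := fun s hs => by
    rw [hC, hw0]
    linear_combination E2 s hs
  obtain ⟨K, hK⟩ : ∃ K, ∀ s ∈ I, w0 s ^ 2 + w1 s ^ 2 + w2 s ^ 2 = K := by
    refine exists_const_of_hasDerivAt_zero hI hIc fun s hs => ?_
    have h := tension_inner_deriv_eq_zero _ _ _ _ _ _ _ _ _ _ _ _ _ _ _ _ C hC hk rfl rfl
      (C2 s hs) (C3 s hs) (C4 s hs) (E0' s hs) (E1' s hs) (E2' s hs)
    refine ((((dw0 s hs).fun_pow 2).fun_add ((dw1 s hs).fun_pow 2)).fun_add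
      ((dw2 s hs).fun_pow 2)).congr_deriv ?_
    simp
    linear_combination 2 * h
  have hK0 : K ≠ 0 := by
    rintro rfl
    obtain ⟨s, hs, hne⟩ := hgeo
    have h := hK s hs
    have h0 : w0 s = 0 := by nlinarith [sq_nonneg (w0 s), sq_nonneg (w1 s), sq_nonneg (w2 s)]
    have h1 : w1 s = 0 := by nlinarith [sq_nonneg (w0 s), sq_nonneg (w1 s), sq_nonneg (w2 s)]
    have h2 : w2 s = 0 := by nlinarith [sq_nonneg (w0 s), sq_nonneg (w1 s), sq_nonneg (w2 s)]
    rw [hten s hs, h0, h1, h2] at hne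
    simp at hne
  have dm : ∀ s ∈ I, HasDerivAt (fun s => x s * w2 s - y s * w1 s) ((w1 s - C * u s * y s) * w2 s
      + x s * deriv w2 s - (w2 s + C * u s * x s) * w1 s - y s * deriv w1 s) s := fun s hs =>
    (((dx s hs).fun_mul (dw2 s hs)).fun_sub ((dy s hs).fun_mul (dw1 s hs))).congr_deriv (by ring)
  have dm' : ∀ s ∈ I, deriv (deriv fun s => x s * w2 s - y s * w1 s) s
      = (deriv w1 s - C * (w0 s * y s + u s * (w2 s + C * u s * x s))) * w2 s
        + 2 * (w1 s - C * u s * y s) * deriv w2 s + x s * deriv (deriv w2) s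
        - (deriv w2 s + C * (w0 s * x s + u s * (w1 s - C * u s * y s))) * w1 s
        - 2 * (w2 s + C * u s * x s) * deriv w1 s - y s * deriv (deriv w1) s := fun s hs => by
    have heq : deriv (fun s => x s * w2 s - y s * w1 s) =ᶠ[nhds s] fun s =>
        (w1 s - C * u s * y s) * w2 s + x s * deriv w2 s - (w2 s + C * u s * x s) * w1 s
          - y s * deriv w1 s := by
      filter_upwards [hI.mem_nhds hs] with r hr using (dm r hr).deriv
    rw [heq.deriv_eq]
    have h1 := (dw1 s hs).fun_sub (((du s hs).const_mul C).fun_mul (dy s hs))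
    have h2 := (dw2 s hs).fun_add (((du s hs).const_mul C).fun_mul (dx s hs))
    rw [((((h1.fun_mul (dw2 s hs)).fun_add ((dx s hs).fun_mul (dp2 s hs))).fun_sub
      (h2.fun_mul (dw1 s hs))).fun_sub ((dy s hs).fun_mul (dp1 s hs))).deriv]
    ring
  -- `E0'` is a total derivative: the conservation law belonging to the isometric flow of X₁.
  obtain ⟨A, hA⟩ : ∃ A, ∀ s ∈ I, deriv w0 s + 2 * τ * (x s * w2 s - y s * w1 s) = A := by
    refine exists_const_of_hasDerivAt_zero hI hIc fun s hs => ?_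
    refine ((dp0 s hs).fun_add ((dm s hs).const_mul (2 * τ))).congr_deriv ?_
    linear_combination E0' s hs
  have cu : ContDiffOn ℝ ∞ u I := hu ▸ cT 0
  have cm : ContDiffOn ℝ ∞ (fun s => x s * w2 s - y s * w1 s) I :=
    ((hx ▸ cT 1).mul (hW2 ▸ cw 2)).sub ((hy ▸ cT 2).mul (hW1 ▸ cw 1))
  have hw0' : deriv u = w0 := funext fun s => (hw0 s).symm
  refine deriv_eq_zero_of_system hI hτ hK0 cu cm (A := A) ?_ ?_ ?_ hs
  · intro s hs
    rw [hw0']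
    linear_combination hA s hs
  · intro s hs
    rw [hw0', ← hK s hs]
    have h1 := C1 s hs
    have h2 := C2 s hs
    -- Lagrange's identity for (x, y) and (w1, w2), with x w1 + y w2 = -u w0, reads (1 - u²)(K -
    -- w0²) = u² w0² + m².
    grind
  · intro s hs
    rw [dm' s hs, (dm s hs).deriv, hw0']
    exact normal_equation _ _ _ _ _ _ _ _ _ _ _ _ _ _ _ _ _ _ _ C hC hk rfl rfl (C1 s hs)
      (C2 s hs) (C3 s hs) (E1' s hs) (E2' s hs) rfl rfl rfl (hK s hs).symm

/-! ### The angle function and the conclusion -/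

/-- The angle is the integral of the angular speed (x'y - y'x)/ρ². With this β the product (y +
ix)e^{-iβ} has zero derivative, and its value at s₀ is ρ. -/
lemma exists_contDiffOn_angle {I : Set ℝ} (hI : IsOpen I) (hIc : I.OrdConnected)
    (hne : I.Nonempty) {x y : ℝ → ℝ} {ρ : ℝ} (hρ : 0 < ρ) (hx : ContDiffOn ℝ ∞ x I)
    (hy : ContDiffOn ℝ ∞ y I) (hxy : ∀ s ∈ I, x s ^ 2 + y s ^ 2 = ρ ^ 2) :
    ∃ β : ℝ → ℝ, ContDiffOn ℝ ∞ β I ∧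
      ∀ s ∈ I, x s = ρ * Real.sin (β s) ∧ y s = ρ * Real.cos (β s) := by
  obtain ⟨s₀, hs₀⟩ := hne
  have dx : ∀ s ∈ I, HasDerivAt x (deriv x s) s := fun s hs => hasDerivAt_of_contDiffOn hI hx hs
  have dy : ∀ s ∈ I, HasDerivAt y (deriv y s) s := fun s hs => hasDerivAt_of_contDiffOn hI hy hs
  obtain ⟨β₀, hx₀, hy₀⟩ : ∃ β₀ : ℝ, x s₀ = ρ * Real.sin β₀ ∧ y s₀ = ρ * Real.cos β₀ := by
    refine ⟨Complex.arg ⟨y s₀, x s₀⟩, ?_⟩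
    have h1 := Complex.norm_mul_cos_arg ⟨y s₀, x s₀⟩
    have h2 := Complex.norm_mul_sin_arg ⟨y s₀, x s₀⟩
    have hn : ‖(⟨y s₀, x s₀⟩ : ℂ)‖ = ρ := by
      rw [Complex.norm_def, Complex.normSq_mk, ← Real.sqrt_sq hρ.le, ← hxy s₀ hs₀]
      congr 1; ring
    rw [hn] at h1 h2
    exact ⟨h2.symm, h1.symm⟩
  set f : ℝ → ℝ := fun s => (deriv x s * y s - deriv y s * x s) / ρ ^ 2 with hf
  have cf : ContDiffOn ℝ ∞ f I := (((hx.deriv_of_isOpen hI (by simp)).mul hy).sub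
    ((hy.deriv_of_isOpen hI (by simp)).mul hx)).div_const _
  set β : ℝ → ℝ := fun s => β₀ + ∫ r in s₀..s, f r with hβ
  have dβ : ∀ s ∈ I, HasDerivAt β (f s) s := fun s hs =>
    (intervalIntegral.integral_hasDerivAt_right
      (cf.continuousOn.mono (hIc.uIcc_subset hs₀ hs)).intervalIntegrable
      (cf.continuousOn.stronglyMeasurableAtFilter hI s hs)
      (cf.continuousOn.continuousAt (hI.mem_nhds hs))).const_add β₀
  have cβ : ContDiffOn ℝ ∞ β I := by
    rw [contDiffOn_infty_iff_deriv_of_isOpen hI]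
    exact ⟨fun s hs => (dβ s hs).differentiableAt.differentiableWithinAt,
      cf.congr fun s hs => (dβ s hs).deriv⟩
  have hρ2 : ρ ^ 2 ≠ 0 := by positivity
  have hxx : ∀ s ∈ I, deriv x s = f s * y s ∧ deriv y s = - f s * x s := by
    intro s hs
    have h := eq_zero_of_hasDerivAt_of_const hI hxy hs (((dx s hs).fun_pow 2).fun_add
      ((dy s hs).fun_pow 2))
    have h2 := hxy s hs
    simp at h
    constructor
    · have : deriv x s * ρ ^ 2 = (deriv x s * y s - deriv y s * x s) * y s := by
        rw [← h2]; linear_combination x s * h / 2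
      simp only [hf]; field_simp; linear_combination this
    · have : deriv y s * ρ ^ 2 = - (deriv x s * y s - deriv y s * x s) * x s := by
        rw [← h2]; linear_combination y s * h / 2
      simp only [hf]; field_simp; linear_combination this
  obtain ⟨a, ha⟩ : ∃ a, ∀ s ∈ I, x s * Real.sin (β s) + y s * Real.cos (β s) = a := by
    refine exists_const_of_hasDerivAt_zero hI hIc fun s hs => ?_
    refine (((dx s hs).fun_mul (dβ s hs).sin).fun_add
      ((dy s hs).fun_mul (dβ s hs).cos)).congr_deriv ?_
    rw [(hxx s hs).1, (hxx s hs).2]; ring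
  obtain ⟨b, hb⟩ : ∃ b, ∀ s ∈ I, x s * Real.cos (β s) - y s * Real.sin (β s) = b := by
    refine exists_const_of_hasDerivAt_zero hI hIc fun s hs => ?_
    refine (((dx s hs).fun_mul (dβ s hs).cos).fun_sub
      ((dy s hs).fun_mul (dβ s hs).sin)).congr_deriv ?_
    rw [(hxx s hs).1, (hxx s hs).2]; ring
  have hβ₀ : β s₀ = β₀ := by simp [hβ]
  have ha' : a = ρ := by
    rw [← ha s₀ hs₀, hβ₀, hx₀, hy₀]; linear_combination ρ * Real.sin_sq_add_cos_sq β₀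
  have hb' : b = 0 := by
    rw [← hb s₀ hs₀, hβ₀, hx₀, hy₀]; ring
  subst ha' hb'
  refine ⟨β, cβ, fun s hs => ?_⟩
  have h1 := ha s hs
  have h2 := hb s hs
  have h3 := Real.sin_sq_add_cos_sq (β s)
  constructor
  · linear_combination Real.sin (β s) * h1 + Real.cos (β s) * h2 - x s * h3
  · linear_combination Real.cos (β s) * h1 - Real.sin (β s) * h2 - y s * h3

lemma hasConstantHopfAngle_of_velocity {τ : ℝ} (hτ : τ ≠ 0) {I : Set ℝ} (hI : IsOpen I)
    (hIc : I.OrdConnected) (hne : I.Nonempty) {c : ℝ → ℂ × ℂ} (hc : ContDiffOn ℝ ∞ c I)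
    (hSL : ∀ s ∈ I, c s ∈ SL2) (harc : ∀ s ∈ I, metric τ (c s) (deriv c s) (deriv c s) = 1)
    {u : ℝ} (hu : ∀ s ∈ I, velocity τ c 0 s = u) (hu1 : u ^ 2 < 1) :
    HasConstantHopfAngle τ c I (Real.arccos u) := by
  have hcos : Real.cos (Real.arccos u) = u := Real.cos_arccos (by nlinarith) (by nlinarith)
  constructor
  · intro s hs
    have h := hu s hs
    unfold velocity at h
    rw [angle, h, harc s hs, metric_frame hτ (hSL s hs)]
    simp
  · have hsin : 0 < Real.sin (Real.arccos u) := by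
      rw [Real.sin_arccos]; exact Real.sqrt_pos.2 (by linarith)
    obtain ⟨β, cβ, hβ⟩ := exists_contDiffOn_angle hI hIc hne hsin (contDiffOn_velocity τ hI hc 1)
      (contDiffOn_velocity τ hI hc 2) (fun s hs => by
        have h := velocity_sq_sum hτ hI hc hSL hs
        rw [harc s hs, hu s hs] at h
        rw [Real.sin_sq, hcos]
        linarith)
    refine ⟨β, cβ, fun s hs => ?_⟩
    rw [deriv_eq_sum_velocity hτ hI hc hSL hs, Fin.sum_univ_three, hu s hs, (hβ s hs).1,
      (hβ s hs).2, hcos]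

/-- If u² ≥ 1, unit speed leaves no horizontal velocity, so all velocity components are constant,
the quadratic terms vanish, and the curve is a geodesic. -/
lemma velocity_sq_lt_one {τ : ℝ} (hτ : τ ≠ 0) {I : Set ℝ} (hI : IsOpen I)
    {γ : ℝ → ℂ × ℂ} (hγ : ContDiffOn ℝ ∞ γ I) (hSL : ∀ s ∈ I, γ s ∈ SL2)
    (harc : ∀ s ∈ I, metric τ (γ s) (deriv γ s) (deriv γ s) = 1)
    (hgeo : ¬ IsGeodesic τ γ I) {u : ℝ} (hu : ∀ s ∈ I, velocity τ γ 0 s = u) : u ^ 2 < 1 := by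
  by_contra hlt
  push Not at hlt
  refine hgeo fun s hs => ?_
  have hzero : ∀ r ∈ I, velocity τ γ 1 r = 0 ∧ velocity τ γ 2 r = 0 := fun r hr => by
    have h := velocity_sq_sum hτ hI hγ hSL hr
    rw [harc r hr, hu r hr] at h
    constructor <;> nlinarith [sq_nonneg (velocity τ γ 1 r), sq_nonneg (velocity τ γ 2 r)]
  have hd := fun k => hasDerivAt_of_contDiffOn hI (contDiffOn_velocity τ hI hγ k) hs
  rw [tension_eq hτ γ (hSL s hs), eq_zero_of_hasDerivAt_of_const hI hu hs (hd 0),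
    eq_zero_of_hasDerivAt_of_const hI (fun r hr => (hzero r hr).1) hs (hd 1),
    eq_zero_of_hasDerivAt_of_const hI (fun r hr => (hzero r hr).2) hs (hd 2), (hzero s hs).1,
    (hzero s hs).2]
  simp

end SLTau

theorem mainTheorem4 (τ : ℝ) (hτ : 0 < τ)
    (I : Set ℝ) (hI : IsOpen I) (hIc : I.OrdConnected)
    (γ : ℝ → ℂ × ℂ) (hγ : ContDiffOn ℝ ∞ γ I) (hSL : ∀ s ∈ I, γ s ∈ SLTau.SL2)
    (harc : ∀ s ∈ I, SLTau.metric τ (γ s) (deriv γ s) (deriv γ s) = 1)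
    (hbi : SLTau.IsProperBiharmonic τ γ I) :
    (∃ ϑ ∈ Ioo 0 Real.pi, SLTau.HasConstantHopfAngle τ γ I ϑ) ∧
    (∃ ϑ ∈ Ioc 0 (Real.pi / 2),
      SLTau.HasConstantHopfAngle τ γ I ϑ ∨
      SLTau.HasConstantHopfAngle τ (fun s => γ (-s)) {s | -s ∈ I} ϑ) := by
  have hτ0 := hτ.ne'
  have hne : I.Nonempty := by
    by_contra h
    rw [not_nonempty_iff_eq_empty] at h
    exact hbi.2 fun s hs => by simp [h] at hs
  obtain ⟨u, hu⟩ := SLTau.exists_const_of_hasDerivAt_zero hI hIc fun s hs =>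
    (SLTau.hasDerivAt_of_contDiffOn hI (SLTau.contDiffOn_velocity τ hI hγ 0) hs).congr_deriv
      (SLTau.deriv_velocity_zero_eq_zero hτ0 hI hIc hγ hSL harc hbi hs)
  have hu1 := SLTau.velocity_sq_lt_one hτ0 hI hγ hSL harc hbi.2 hu
  have h := SLTau.hasConstantHopfAngle_of_velocity hτ0 hI hIc hne hγ hSL harc hu hu1
  have hpos : ∀ {v : ℝ}, v ^ 2 < 1 → 0 < Real.arccos v := fun hv =>
    Real.arccos_pos.2 (by nlinarith)
  refine ⟨⟨Real.arccos u, ⟨hpos hu1, ?_⟩, h⟩, ?_⟩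
  · refine lt_of_le_of_ne (Real.arccos_le_pi u) fun h => ?_
    rw [Real.arccos_eq_pi] at h
    nlinarith
  rcases le_or_gt 0 u with h0 | h0
  · exact ⟨Real.arccos u, ⟨hpos hu1, Real.arccos_le_pi_div_two.2 h0⟩, Or.inl h⟩
  have hd : ∀ s, deriv (fun s => γ (-s)) s = -deriv γ (-s) := fun s => deriv_comp_neg γ s
  have hJ : IsOpen {s | -s ∈ I} := hI.preimage continuous_neg
  have hJc : ({s | -s ∈ I} : Set ℝ).OrdConnected := by
    constructor
    intro a ha b hb s hs
    exact hIc.out hb ha ⟨neg_le_neg hs.2, neg_le_neg hs.1⟩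
  -- Reversal negates the velocity and hence u, so an obtuse angle becomes acute.
  refine ⟨Real.arccos (-u), ⟨hpos (by linarith [neg_sq u]),
    Real.arccos_le_pi_div_two.2 (by linarith)⟩, Or.inr ?_⟩
  refine SLTau.hasConstantHopfAngle_of_velocity (c := fun s => γ (-s)) hτ0 hJ hJc ?_
    (hγ.comp contDiff_neg.contDiffOn fun s hs => hs) (fun s hs => hSL (-s) hs) ?_ ?_ (by rwa [neg_sq])
  · obtain ⟨s, hs⟩ := hne
    exact ⟨-s, by simpa using hs⟩
  · intro s hs
    rw [hd, SLTau.metric_neg_left, SLTau.metric_comm, SLTau.metric_neg_left, neg_neg]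
    exact harc (-s) hs
  · intro s hs
    rw [SLTau.velocity, hd, SLTau.metric_neg_left]
    exact congrArg Neg.neg (hu (-s) hs)
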